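/- Let $n\ge 1$ and let $\mathcal M=\mathrm{SL}(2n,\mathbb C)$, regarded as a real manifold. Let $K=\mathrm{SU}(2n)$ and let $B$ be the group of upper triangular matrices in $\mathrm{SL}(2n,\mathbb C)$ with real, positive diagonal entries; every $g\in\mathcal M$ is uniquely $g=kb$ with $k\in K$, $b\in B$. Put $I=\mathrm{diag}(\mathbf 1_n,-\mathbf 1_n)$, $K_+=\{k\in K : k^\dagger I k=I\}$, and, for $g=kb$, $$\Omega(g)=bb^\dagger,\qquad L(g)=k^\dagger I k I .$$ On $\mathfrak g=\mathfrak{sl}(2n,\mathbb C)=\mathrm{Lie}(K)\oplus\mathrm{Lie}(B)$ put $\langle X,Y\rangle=\operatorname{Im}\operatorname{tr}(XY)$ and $\mathcal R=\tfrac12(P_{\mathfrak k}-P_{\mathfrak b})$, where $P_{\mathfrak k},P_{\mathfrak b}$ are the projections onto $\mathfrak k=\mathrm{Lie}(K)$ and $\mathfrak b=\mathrm{Lie}(B)$. For a smooth function $\varphi:\mathcal M\to\mathbb R$ define $\nabla_g\varphi,\nabla'_g\varphi\in\mathfrak g$ by $$\frac{d}{dt}\Big|_{t=0}\varphi(e^{tX}ge^{tY})=\langle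 X,\nabla_g\varphi\rangle+\langle Y,\nabla'_g\varphi\rangle\qquad\forall X,Y\in\mathfrak g,$$ and define the Poisson bracket of the Heisenberg double by $$\{\varphi,\psi\}(g)=\langle\nabla_g\varphi,\mathcal R\nabla_g\psi\rangle+\langle\nabla'_g\varphi,\mathcal R\nabla'_g\psi\rangle .$$ The Hamiltonian vector field $\mathbb X_H$ of a smooth function $H$ is the vector field on $\mathcal M$ with $d\varphi(\mathbb X_H)=\{\varphi,H\}$ for all smooth $\varphi$. The components $\dot k\in T_kK$, $\dot b\in T_bB$ of a tangent vector $\dot g$ at $g=kb$ are given by $\dot g=\dot k b+k\dot b$. For $l=1,2,\dots$ let $$F_l(g)=\frac1{2l}\operatorname{tr}\Omega(g)^l,\qquad \Phi_l(g)=\frac1{2l}\operatorname{tr}L(g)^l .$$ Then: 1. All $F_l$ and $\Phi_l$ are real valued smooth functions on $\mathcal M$, and they are invariant under the action $(f_1,f_2): g\mapsto f_1gf_2^\dagger$ of $K_+\times K_+$. 2. $\{F_{l_1},F_{l_2}\}=0$ and $\{\Phi_{l_1},\Phi_{l_2}\}=0$ for all $l_1,l_2\ge1$. 3. For every $l\ge1$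 the Hamiltonian vector field of $F_l$ exists, is unique, and has at $g=kb$ the components $$\dot k=\mathrm i\,k\,[\Omega^l-\nu_l\mathbf 1_{2n}],\qquad \dot b=0,\qquad \nu_l=\frac1{2n}\operatorname{tr}\Omega^l .$$ 4. For every $l\ge1$ the Hamiltonian vector field of $\Phi_l$ exists, is unique, and has at $g=kb$ the components $$\dot k=\tfrac12\mathrm i\,k\,(IL^{l-1}-L^{l+1}I-IL^l+L^lI),\qquad \dot b=\tfrac12\mathrm i\,(\mathbf 1_{2n}+I)L^l(\mathbf 1_{2n}-I)\,b .$$ 5. Each of these vector fields generates a complete flow on $\mathcal M$: there is a continuous one-parameter group $(\sigma_t)_{t\in\mathbb R}$ of transformations of $\mathcal M$ such that $t\mapsto\sigma_t(g)$ is an integral curve of the vector field for every $g$, and every integral curve defined on an open interval containing $0$ is the restriction of such an orbit. -/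

import Mathlib

open Matrix Filter Topology
open scoped Matrix ContDiff Matrix.Norms.Operator

noncomputable section

namespace HeisenbergDouble

/-- Complex `2n × 2n` matrices, as a real normed space. -/
abbrev Mat (n : ℕ) : Type := Matrix (Fin (2 * n)) (Fin (2 * n)) ℂ

/-- The phase space `SL(2n, ℂ)`. -/
abbrev M (n : ℕ) : Type := Matrix.SpecialLinearGroup (Fin (2 * n)) ℂ

/-- The Lie algebra `sl(2n, ℂ)`: traceless matrices, as a real vector space. -/
def sl (n : ℕ) : Submodule ℝ (Mat n) :=
  LinearMap.ker (Matrix.traceLinearMap (Fin (2 * n)) ℝ ℂ)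

theorem mem_sl {n : ℕ} {X : Mat n} : X ∈ sl n ↔ X.trace = 0 := Iff.rfl

/-! ### The subgroups `K`, `B`, `K₊` and the decomposition `g = k b` -/

/-- `K = SU(2n)`. -/
def K (n : ℕ) : Subgroup (M n) where
  carrier := {g | (g : Mat n)ᴴ * (g : Mat n) = 1}
  one_mem' := by simp
  mul_mem' := by
    intro a b ha hb
    simp only [Set.mem_ofPred_eq, Matrix.SpecialLinearGroup.coe_mul, conjTranspose_mul] at *
    rw [Matrix.mul_assoc, ← Matrix.mul_assoc (a : Mat n)ᴴ, ha, Matrix.one_mul, hb]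
  inv_mem' := by
    intro a ha
    simp only [Set.mem_ofPred_eq] at *
    have h1 : (a : Mat n) * ((a⁻¹ : M n) : Mat n) = 1 := by
      rw [← Matrix.SpecialLinearGroup.coe_mul, mul_inv_cancel, Matrix.SpecialLinearGroup.coe_one]
    have h2 : (a : Mat n)ᴴ = ((a⁻¹ : M n) : Mat n) := by
      calc (a : Mat n)ᴴ = (a : Mat n)ᴴ * ((a : Mat n) * ((a⁻¹ : M n) : Mat n)) := by
            rw [h1, Matrix.mul_one]
        _ = _ := by rw [← Matrix.mul_assoc, ha, Matrix.one_mul]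
    rw [← h2, conjTranspose_conjTranspose]
    exact mul_eq_one_comm.mp ha

theorem mem_K_iff {n : ℕ} {g : M n} :
    g ∈ K n ↔ (g : Mat n) ∈ Matrix.specialUnitaryGroup (Fin (2 * n)) ℂ := by
  rw [Matrix.mem_specialUnitaryGroup_iff, Matrix.mem_unitaryGroup_iff']
  exact ⟨fun h => ⟨h, g.2⟩, fun h => h.1⟩

/-- `B`: upper triangular matrices in `SL(2n, ℂ)` with real, positive diagonal entries. -/
def B (n : ℕ) : Subgroup (M n) where
  carrier := {g | (∀ i j, j < i → (g : Mat n) i j = 0) ∧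
    ∀ i, 0 < ((g : Mat n) i i).re ∧ ((g : Mat n) i i).im = 0}
  one_mem' := by
    refine ⟨fun i j h => ?_, fun i => ?_⟩
    · simp [Matrix.one_apply_ne h.ne']
    · simp
  mul_mem' := by
    rintro a b ⟨ha, ha'⟩ ⟨hb, hb'⟩
    have hab : ∀ i j, j ≤ i → ((a * b : M n) : Mat n) i j
        = if i = j then (a : Mat n) i i * (b : Mat n) i i else 0 := by
      intro i j hij
      rw [Matrix.SpecialLinearGroup.coe_mul, Matrix.mul_apply]
      have hz : ∀ x, x ≠ i → (a : Mat n) i x * (b : Mat n) x j = 0 := by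
        intro x hx
        rcases lt_or_gt_of_ne hx with h | h
        · rw [ha i x h, zero_mul]
        · rw [hb x j (lt_of_le_of_lt hij h), mul_zero]
      rw [Finset.sum_eq_single i (fun x _ hx => hz x hx) (by simp)]
      split_ifs with h
      · rw [h]
      · rw [hb i j (lt_of_le_of_ne hij (Ne.symm h)), mul_zero]
    refine ⟨fun i j h => ?_, fun i => ?_⟩
    · rw [hab i j h.le, if_neg h.ne']
    · rw [hab i i le_rfl, if_pos rfl]
      obtain ⟨h1, h2⟩ := ha' i
      obtain ⟨h3, h4⟩ := hb' i
      simp [Complex.mul_re, Complex.mul_im, h2, h4, mul_pos h1 h3]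
  inv_mem' := by
    rintro a ⟨ha, ha'⟩
    have h1 : (a : Mat n) * ((a⁻¹ : M n) : Mat n) = 1 := by
      rw [← Matrix.SpecialLinearGroup.coe_mul, mul_inv_cancel, Matrix.SpecialLinearGroup.coe_one]
    have hinv : ((a⁻¹ : M n) : Mat n) = (a : Mat n)⁻¹ := (Matrix.inv_eq_right_inv h1).symm
    have : Invertible (a : Mat n) := invertibleOfRightInverse (a : Mat n) _ h1
    have hT : ∀ i j, j < i → ((a⁻¹ : M n) : Mat n) i j = 0 := by
      have := Matrix.blockTriangular_inv_of_blockTriangular (M := (a : Mat n)) (b := id)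
        (fun i j h => ha i j h)
      intro i j h
      rw [hinv]
      exact this h
    refine ⟨hT, fun i => ?_⟩
    have hd : (a : Mat n) i i * ((a⁻¹ : M n) : Mat n) i i = 1 := by
      have h2 := congrFun (congrFun h1 i) i
      rw [Matrix.mul_apply, Finset.sum_eq_single i, Matrix.one_apply_eq] at h2
      · exact h2
      · intro x _ hx
        rcases lt_or_gt_of_ne hx with h | h
        · rw [ha i x h, zero_mul]
        · rw [hT x i h, mul_zero]
      · simp
    obtain ⟨hp, hi⟩ := ha' i
    have hre := congrArg Complex.re hd
    have him := congrArg Complex.im hd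
    simp only [Complex.mul_re, Complex.mul_im, hi, zero_mul, sub_zero, add_zero,
      Complex.one_re, Complex.one_im] at hre him
    refine ⟨?_, ?_⟩
    · by_contra hneg
      push Not at hneg
      nlinarith
    · rcases mul_eq_zero.mp him with h | h
      · exact absurd h hp.ne'
      · exact h

/-- The matrix `I = diag(1ₙ, -1ₙ)`. -/
def Inn (n : ℕ) : Mat n := Matrix.diagonal fun i => if i.val < n then 1 else -1

/-- `K₊ = {k ∈ K | k† I k = I}`. -/
def Kplus (n : ℕ) : Subgroup (M n) where
  carrier := {k | k ∈ K n ∧ (k : Mat n)ᴴ * Inn n * (k : Mat n) = Inn n}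
  one_mem' := ⟨(K n).one_mem, by simp⟩
  mul_mem' := by
    rintro a b ⟨ha, ha'⟩ ⟨hb, hb'⟩
    refine ⟨(K n).mul_mem ha hb, ?_⟩
    rw [Matrix.SpecialLinearGroup.coe_mul, conjTranspose_mul]
    calc (b : Mat n)ᴴ * (a : Mat n)ᴴ * Inn n * ((a : Mat n) * (b : Mat n))
        = (b : Mat n)ᴴ * ((a : Mat n)ᴴ * Inn n * (a : Mat n)) * (b : Mat n) := by
          simp only [Matrix.mul_assoc]
      _ = Inn n := by rw [ha', hb']
  inv_mem' := by
    rintro a ⟨ha, ha'⟩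
    refine ⟨(K n).inv_mem ha, ?_⟩
    have h1 : (a : Mat n) * ((a⁻¹ : M n) : Mat n) = 1 := by
      rw [← Matrix.SpecialLinearGroup.coe_mul, mul_inv_cancel, Matrix.SpecialLinearGroup.coe_one]
    have h2 : ((a⁻¹ : M n) : Mat n)ᴴ * (a : Mat n)ᴴ = 1 := by
      rw [← conjTranspose_mul, h1, conjTranspose_one]
    calc ((a⁻¹ : M n) : Mat n)ᴴ * Inn n * ((a⁻¹ : M n) : Mat n)
        = ((a⁻¹ : M n) : Mat n)ᴴ * ((a : Mat n)ᴴ * Inn n * (a : Mat n)) *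
            ((a⁻¹ : M n) : Mat n) := by rw [ha']
      _ = (((a⁻¹ : M n) : Mat n)ᴴ * (a : Mat n)ᴴ) * Inn n *
            ((a : Mat n) * ((a⁻¹ : M n) : Mat n)) := by simp only [Matrix.mul_assoc]
      _ = Inn n := by rw [h1, h2, Matrix.one_mul, Matrix.mul_one]

theorem K_inf_B {n : ℕ} {u : M n} (hK : u ∈ K n) (hB : u ∈ B n) : u = 1 := by
  have hK' : (u : Mat n)ᴴ * (u : Mat n) = 1 := hK
  have hBi := (B n).inv_mem hB
  have h1 : (u : Mat n) * ((u⁻¹ : M n) : Mat n) = 1 := by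
    rw [← Matrix.SpecialLinearGroup.coe_mul, mul_inv_cancel, Matrix.SpecialLinearGroup.coe_one]
  have h2 : (u : Mat n)ᴴ = ((u⁻¹ : M n) : Mat n) := by
    calc (u : Mat n)ᴴ = (u : Mat n)ᴴ * ((u : Mat n) * ((u⁻¹ : M n) : Mat n)) := by
          rw [h1, Matrix.mul_one]
      _ = _ := by rw [← Matrix.mul_assoc, hK', Matrix.one_mul]
  have hup : ∀ i j, i < j → (u : Mat n) i j = 0 := by
    intro i j hij
    have h3 := hBi.1 j i hij
    rw [← h2, conjTranspose_apply] at h3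
    simpa using h3
  ext i j
  rw [Matrix.SpecialLinearGroup.coe_one]
  rcases lt_trichotomy i j with h | h | h
  · rw [hup i j h, Matrix.one_apply_ne h.ne]
  · subst h
    rw [Matrix.one_apply_eq]
    have h4 := congrFun (congrFun hK' i) i
    rw [Matrix.mul_apply, Finset.sum_eq_single i, Matrix.one_apply_eq, conjTranspose_apply] at h4
    · obtain ⟨hp, hi⟩ := hB.2 i
      have hre := congrArg Complex.re h4
      simp [Complex.mul_re, hi] at hre
      apply Complex.ext
      · rw [Complex.one_re]; nlinarith
      · rw [hi, Complex.one_im]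
    · intro x _ hx
      rcases lt_or_gt_of_ne hx with h | h
      · rw [hup x i h, mul_zero]
      · rw [hB.1 x i h, mul_zero]
    · simp
  · rw [hB.1 i j h, Matrix.one_apply_ne h.ne']

/-- Gram-Schmidt factorization: every `g ∈ SL(2n, ℂ)` is `k b` with unique `k ∈ K`, `b ∈ B`. -/
theorem existsUnique_KB {n : ℕ} (g : M n) :
    ∃! p : M n × M n, p.1 ∈ K n ∧ p.2 ∈ B n ∧ p.1 * p.2 = g := by
  have hdet : IsUnit (g : Mat n).det := by rw [g.2]; exact isUnit_one
  -- the columns of `g`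
  let f : Fin (2 * n) → EuclideanSpace ℂ (Fin (2 * n)) := fun j => WithLp.toLp 2 fun i => (g : Mat n) i j
  have hli : LinearIndependent ℂ f := by
    have h1 : LinearIndependent ℂ (g : Mat n).col :=
      Matrix.linearIndependent_cols_of_isUnit ((Matrix.isUnit_iff_isUnit_det _).2 hdet)
    exact h1.map' (WithLp.linearEquiv 2 ℂ (Fin (2 * n) → ℂ)).symm.toLinearMap
      (LinearEquiv.ker _)
  let e := InnerProductSpace.gramSchmidtNormed ℂ f
  have he : Orthonormal ℂ e := InnerProductSpace.gramSchmidtNormed_orthonormal hli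
  let k : Mat n := Matrix.of fun i j => e j i
  have hk : kᴴ * k = 1 := by
    ext i j
    have := orthonormal_iff_ite.1 he i j
    rw [Matrix.mul_apply, Matrix.one_apply, ← this, PiLp.inner_apply]
    simp [k, Matrix.conjTranspose_apply, mul_comm]
  have hk' : k * kᴴ = 1 := mul_eq_one_comm.mp hk
  let b : Mat n := kᴴ * (g : Mat n)
  have hbe : ∀ i j, b i j = inner ℂ (e i) (f j) := by
    intro i j
    rw [PiLp.inner_apply]
    simp [b, k, f, Matrix.mul_apply, Matrix.conjTranspose_apply, mul_comm]
  have htri : ∀ i j, j < i → b i j = 0 := by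
    intro i j hij
    rw [hbe]
    simp only [e, InnerProductSpace.gramSchmidtNormed, inner_smul_left]
    rw [InnerProductSpace.gramSchmidt_inv_triangular ℂ f hij, mul_zero]
  have hdiag : ∀ i, ∃ r : ℝ, 0 < r ∧ b i i = r := by
    intro i
    have hne : InnerProductSpace.gramSchmidt ℂ f i ≠ 0 :=
      InnerProductSpace.gramSchmidt_ne_zero i hli
    have hin : inner ℂ (InnerProductSpace.gramSchmidt ℂ f i) (f i)
        = ((‖InnerProductSpace.gramSchmidt ℂ f i‖ : ℂ)) ^ 2 := by
      conv_lhs => rw [InnerProductSpace.gramSchmidt_def'' ℂ f i]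
      rw [inner_add_right, inner_sum, inner_self_eq_norm_sq_to_K, Finset.sum_eq_zero, add_zero]
      · simp
      · intro x hx
        rw [inner_smul_right, InnerProductSpace.gramSchmidt_orthogonal ℂ f
          (Finset.mem_Iio.1 hx).ne', mul_zero]
    have hpos : 0 < ‖InnerProductSpace.gramSchmidt ℂ f i‖ := norm_pos_iff.2 hne
    refine ⟨_, hpos, ?_⟩
    rw [hbe]
    simp only [e, InnerProductSpace.gramSchmidtNormed, inner_smul_left]
    rw [hin]
    have : ((‖InnerProductSpace.gramSchmidt ℂ f i‖ : ℝ) : ℂ) ≠ 0 := by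
      exact_mod_cast hpos.ne'
    simp
    field_simp
  have hbdet : ∃ r : ℝ, 0 < r ∧ b.det = r := by
    choose r hr hr' using hdiag
    refine ⟨∏ i, r i, Finset.prod_pos fun i _ => hr i, ?_⟩
    rw [Matrix.det_of_isUpperTriangular (M := b) (fun i j h => htri i j h)]
    push_cast
    exact Finset.prod_congr rfl fun i _ => hr' i
  have hkb : k * b = (g : Mat n) := by
    simp only [b]
    rw [← Matrix.mul_assoc, hk', Matrix.one_mul]
  have hdets : k.det = 1 ∧ b.det = 1 := by
    obtain ⟨r, hr, hrb⟩ := hbdet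
    have h1 : k.det * b.det = 1 := by rw [← Matrix.det_mul, hkb, g.2]
    have h2 : star k.det * k.det = 1 := by
      rw [← Matrix.det_conjTranspose, ← Matrix.det_mul, hk, Matrix.det_one]
    have h3 : b.det = star k.det := by
      calc b.det = (star k.det * k.det) * b.det := by rw [h2, one_mul]
        _ = star k.det := by rw [mul_assoc, h1, mul_one]
    have h4 : k.det = r := by
      have := congrArg star h3
      rw [star_star, hrb] at this
      rw [← this]; simp
    have h5 : r * r = 1 := by
      have := h1
      rw [h4, hrb] at this
      exact_mod_cast this
    have h6 : r = 1 := by nlinarith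
    rw [h4, hrb, h6]
    simp
  obtain ⟨k₁, hk₁⟩ : ∃ k₁ : M n, (k₁ : Mat n) = k := ⟨⟨k, hdets.1⟩, rfl⟩
  obtain ⟨b₁, hb₁⟩ : ∃ b₁ : M n, (b₁ : Mat n) = b := ⟨⟨b, hdets.2⟩, rfl⟩
  have hK : k₁ ∈ K n := by
    show (k₁ : Mat n)ᴴ * (k₁ : Mat n) = 1
    rw [hk₁, hk]
  have hB : b₁ ∈ B n := by
    show (∀ i j, j < i → (b₁ : Mat n) i j = 0) ∧
      ∀ i, 0 < ((b₁ : Mat n) i i).re ∧ ((b₁ : Mat n) i i).im = 0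
    rw [hb₁]
    refine ⟨htri, fun i => ?_⟩
    obtain ⟨r, hr, hr'⟩ := hdiag i
    rw [hr']
    exact ⟨by simpa using hr, by simp⟩
  have hg : k₁ * b₁ = g := by
    apply Subtype.ext
    rw [Matrix.SpecialLinearGroup.coe_mul, hk₁, hb₁, hkb]
  refine ⟨(k₁, b₁), ⟨hK, hB, hg⟩, ?_⟩
  · rintro ⟨k₂, b₂⟩ ⟨h1, h2, h3⟩
    simp only at h1 h2 h3
    have heq : k₁⁻¹ * k₂ = b₁ * b₂⁻¹ := by
      rw [eq_mul_inv_iff_mul_eq, mul_assoc, h3, ← hg, inv_mul_cancel_left]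
    have hu : k₁⁻¹ * k₂ = 1 := K_inf_B ((K n).mul_mem ((K n).inv_mem hK) h1)
      (by rw [heq]; exact (B n).mul_mem hB ((B n).inv_mem h2))
    have hk2 : k₂ = k₁ := by rw [← inv_mul_eq_one.mp hu]
    have hb2 : b₂ = b₁ := by
      rw [heq] at hu
      exact (mul_inv_eq_one.mp hu).symm
    rw [hk2, hb2]

/-- The factor `k` in `g = k b`. -/
def kPart {n : ℕ} (g : M n) : M n := (existsUnique_KB g).choose.1

/-- The factor `b` in `g = k b`. -/
def bPart {n : ℕ} (g : M n) : M n := (existsUnique_KB g).choose.2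

theorem kPart_mem {n : ℕ} (g : M n) : kPart g ∈ K n := (existsUnique_KB g).choose_spec.1.1

theorem bPart_mem {n : ℕ} (g : M n) : bPart g ∈ B n := (existsUnique_KB g).choose_spec.1.2.1

theorem kPart_mul_bPart {n : ℕ} (g : M n) : kPart g * bPart g = g :=
  (existsUnique_KB g).choose_spec.1.2.2

/-! ### The matrix valued maps `Ω`, `L` and the two families of functions -/

/-- `Ω(kb) = b b†`. -/
def Om {n : ℕ} (g : M n) : Mat n := (bPart g : Mat n) * (bPart g : Mat n)ᴴ

/-- `L(kb) = k† I k I`. -/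
def L {n : ℕ} (g : M n) : Mat n := (kPart g : Mat n)ᴴ * Inn n * (kPart g : Mat n) * Inn n

/-- `F_l = (1/2l) tr Ω^l`, as a real number. -/
def F {n : ℕ} (l : ℕ) (g : M n) : ℝ := 1 / (2 * (l : ℝ)) * ((Om g ^ l).trace).re

/-- `Φ_l = (1/2l) tr L^l`, as a real number. -/
def Phi {n : ℕ} (l : ℕ) (g : M n) : ℝ := 1 / (2 * (l : ℝ)) * ((L g ^ l).trace).re

/-! ### The Lie algebra decomposition and the pairing -/

/-- `Lie(K) = su(2n)`. -/
def lieK (n : ℕ) : Set (Mat n) := {X | Xᴴ = -X ∧ X.trace = 0}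

/-- `Lie(B)`: upper triangular traceless matrices with real diagonal. -/
def lieB (n : ℕ) : Set (Mat n) :=
  {X | (∀ i j, j < i → X i j = 0) ∧ (∀ i, (X i i).im = 0) ∧ X.trace = 0}

/-- The projection `P_b` of `sl(2n, ℂ) = Lie(K) + Lie(B)` onto `Lie(B)`. -/
def projB {n : ℕ} (X : Mat n) : Mat n := Matrix.of fun i j =>
  if i < j then X i j + star (X j i) else if i = j then ((X i i).re : ℂ) else 0

/-- The projection `P_k` of `sl(2n, ℂ) = Lie(K) + Lie(B)` onto `Lie(K)`. -/
def projK {n : ℕ} (X : Mat n) : Mat n := X - projB X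

/-- `projK` and `projB` are the two projections of the direct sum decomposition. -/
theorem proj_unique {n : ℕ} {X : Mat n} (hX : X ∈ sl n) (Y Z : Mat n) :
    (Y ∈ lieK n ∧ Z ∈ lieB n ∧ X = Y + Z) ↔ (Y = projK X ∧ Z = projB X) := by
  have hXt : X.trace = 0 := hX
  have hPB : ∀ i j, projB X i j =
      if i < j then X i j + star (X j i) else if i = j then ((X i i).re : ℂ) else 0 :=
    fun i j => rfl
  constructor
  · rintro ⟨⟨hY, -⟩, ⟨hZ, hZ', -⟩, rfl⟩
    have hYij : ∀ i j, star (Y j i) = - Y i j := fun i j => by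
      rw [← conjTranspose_apply, hY, Matrix.neg_apply]
    have hZP : Z = projB (Y + Z) := by
      ext i j
      rw [hPB]
      rcases lt_trichotomy i j with h | h | h
      · rw [if_pos h, Matrix.add_apply, Matrix.add_apply, hZ j i h, add_zero, hYij]
        ring
      · subst h
        rw [if_neg (lt_irrefl _), if_pos rfl, Matrix.add_apply]
        have h1 := congrArg Complex.re (hYij i i)
        simp at h1
        have h2 : (Y i i).re = 0 := by linarith
        apply Complex.ext
        · simp [h2]
        · simp [hZ' i]
      · rw [if_neg h.not_gt, if_neg h.ne', hZ i j h]
    exact ⟨by rw [projK, ← hZP, add_sub_cancel_right], hZP⟩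
  · rintro ⟨rfl, rfl⟩
    have htr : (projB X).trace = 0 := by
      have h1 : (projB X).trace = ((X.trace.re : ℝ) : ℂ) := by
        simp only [Matrix.trace, Matrix.diag_apply, hPB, lt_irrefl, if_false, if_true,
          Complex.re_sum, Complex.ofReal_sum]
      rw [h1, hXt]; simp
    refine ⟨⟨?_, ?_⟩, ⟨?_, ?_, htr⟩, ?_⟩
    · ext i j
      rw [conjTranspose_apply, Matrix.neg_apply, projK, Matrix.sub_apply, Matrix.sub_apply,
        hPB, hPB]
      rcases lt_trichotomy i j with h | h | h
      · rw [if_neg h.not_gt, if_neg h.ne', if_pos h, sub_zero]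
        ring
      · subst h
        rw [if_neg (lt_irrefl _), if_pos rfl]
        apply Complex.ext <;> simp
      · rw [if_pos h, if_neg h.not_gt, if_neg h.ne']
        simp
    · rw [projK, Matrix.trace_sub, hXt, htr, sub_zero]
    · intro i j h
      rw [hPB, if_neg h.not_gt, if_neg h.ne']
    · intro i
      rw [hPB, if_neg (lt_irrefl _), if_pos rfl, Complex.ofReal_im]
    · rw [projK, sub_add_cancel]

/-- `R = (P_k - P_b) / 2`. -/
def R {n : ℕ} (X : Mat n) : Mat n := (1 / 2 : ℝ) • (projK X - projB X)

/-- `⟨X, Y⟩ = Im tr (X Y)`. -/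
def pairing {n : ℕ} (X Y : Mat n) : ℝ := ((X * Y).trace).im

/-! ### Smooth functions, gradients and the Poisson bracket -/

theorem det_exp_eq_one {n : ℕ} {X : Mat n} (hX : X ∈ sl n) : (NormedSpace.exp X).det = 1 := by
  have hXt : X.trace = 0 := hX
  have hd : Differentiable ℝ (fun A : Mat n => A.det) := by
    simp only [Matrix.det_apply]
    have hent : ∀ i j, Differentiable ℝ (fun A : Mat n => A i j) := fun i j =>
      (Matrix.entryLinearMap ℝ ℂ i j : Mat n →ₗ[ℝ] ℂ).toContinuousLinearMap.differentiable
    fun_prop (disch := assumption)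
  have h1 : HasDerivAt (fun t : ℝ => ((1 : Mat n) + t • X).det) 0 0 := by
    have h2 : HasDerivAt (fun t : ℝ => (1 : Mat n) + t • X) X 0 := by
      have h := ((hasDerivAt_id (0 : ℝ)).smul_const X).const_add (1 : Mat n)
      rw [one_smul] at h
      exact h
    have h3 : ∀ t : ℝ, ((1 : Mat n) + t • X).det = 1 + ((t : ℂ)) ^ 2 *
        ((Matrix.det (1 + (Polynomial.X : Polynomial ℂ) • X.map Polynomial.C)).divX.divX.eval (t : ℂ)) := by
      intro t
      have := Matrix.det_one_add_smul (t : ℂ) X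
      rw [hXt] at this
      have h4 : (t : ℂ) • X = t • X := by ext i j; simp
      rw [h4] at this
      rw [this]; ring
    have h5 : ∀ P : Polynomial ℂ, HasDerivAt (fun z : ℂ => 1 + z ^ 2 * P.eval z) 0 ((0 : ℝ) : ℂ) := by
      intro P
      have h6 := (((hasDerivAt_id (0 : ℂ)).pow 2).mul (P.hasDerivAt 0)).const_add 1
      simp at h6
      simpa using h6
    rw [funext h3]
    exact (h5 _).comp_ofReal
  have key : HasDerivAt (fun t : ℝ => (NormedSpace.exp (t • X)).det) 0 0 := by
    have h2 : HasDerivAt (fun t : ℝ => (1 : Mat n) + t • X) X 0 := by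
      have h := ((hasDerivAt_id (0 : ℝ)).smul_const X).const_add (1 : Mat n)
      rw [one_smul] at h
      exact h
    have h3 : HasDerivAt (fun t : ℝ => NormedSpace.exp (t • X)) X 0 := by
      have h := hasDerivAt_exp_smul_const (𝕂 := ℝ) X (0 : ℝ)
      rw [zero_smul, NormedSpace.exp_zero, one_mul] at h
      exact h
    have h4 := (hd (1 + (0 : ℝ) • X)).hasFDerivAt.comp_hasDerivAt (0 : ℝ) h2
    have h5 := (hd (NormedSpace.exp ((0 : ℝ) • X))).hasFDerivAt.comp_hasDerivAt (0 : ℝ) h3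
    have h6 := h4.unique h1
    simp only [zero_smul, add_zero, NormedSpace.exp_zero] at h5 h6
    rw [h6] at h5
    exact h5
  have hall : ∀ s : ℝ, HasDerivAt (fun t : ℝ => (NormedSpace.exp (t • X)).det) 0 s := by
    intro s
    have h1 : (fun t : ℝ => (NormedSpace.exp (t • X)).det) =
        fun t => (NormedSpace.exp (s • X)).det * (NormedSpace.exp ((t - s) • X)).det := by
      funext t
      rw [← Matrix.det_mul, ← Matrix.exp_add_of_commute]
      · rw [← add_smul, add_sub_cancel]
      · exact ((Commute.refl X).smul_left s).smul_right (t - s)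
    rw [h1]
    have h2 : HasDerivAt (fun t : ℝ => (NormedSpace.exp ((t - s) • X)).det) 0 s := by
      have h3 : HasDerivAt (fun t : ℝ => (NormedSpace.exp (t • X)).det) 0 (s - s) := by
        rw [sub_self]; exact key
      exact h3.comp_sub_const s s
    simpa using h2.const_mul (NormedSpace.exp (s • X)).det
  have hc := is_const_of_deriv_eq_zero (fun s => (hall s).differentiableAt)
    (fun s => (hall s).deriv) 1 0
  simpa using hc

/-- The exponential map `sl(2n, ℂ) → SL(2n, ℂ)`. -/
def expSL {n : ℕ} (X : sl n) : M n := ⟨NormedSpace.exp (X : Mat n), det_exp_eq_one X.2⟩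

/-- `C^∞(M)` for `M = SL(2n, ℂ)` as a real (embedded) submanifold of the space of matrices:
locally, `φ` is the restriction of a smooth function of the ambient space. -/
def IsSmooth {n : ℕ} (φ : M n → ℝ) : Prop :=
  ∀ g : M n, ∃ U : Set (Mat n), IsOpen U ∧ (g : Mat n) ∈ U ∧
    ∃ f : Mat n → ℝ, ContDiffOn ℝ ∞ f U ∧ ∀ h : M n, (h : Mat n) ∈ U → φ h = f h

/-- `Z = ∇_g φ` and `Z' = ∇'_g φ`:
`d/dt φ(e^{tX} g e^{tY})` at `t = 0` is `⟨X, Z⟩ + ⟨Y, Z'⟩` for all `X, Y ∈ sl(2n, ℂ)`. -/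
def IsGradient {n : ℕ} (φ : M n → ℝ) (g : M n) (Z Z' : sl n) : Prop :=
  ∀ X Y : sl n, HasDerivAt (fun t : ℝ => φ (expSL (t • X) * g * expSL (t • Y)))
    (pairing (X : Mat n) Z + pairing (Y : Mat n) Z') 0

open scoped ComplexOrder in
theorem existsUnique_gradient {n : ℕ} {φ : M n → ℝ} (hφ : IsSmooth φ) (g : M n) :
    ∃! Z : sl n × sl n, IsGradient φ g Z.1 Z.2 := by
  obtain ⟨U, hU, hgU, f, hf, hφf⟩ := hφ g
  have hfd : HasFDerivAt f (fderiv ℝ f (g : Mat n)) (g : Mat n) :=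
    ((hf.contDiffAt (hU.mem_nhds hgU)).differentiableAt (by simp)).hasFDerivAt
  set D := fderiv ℝ f (g : Mat n)
  have hder : ∀ X Y : sl n, HasDerivAt (fun t : ℝ => φ (expSL (t • X) * g * expSL (t • Y)))
      (D ((X : Mat n) * (g : Mat n)) + D ((g : Mat n) * (Y : Mat n))) 0 := by
    intro X Y
    have hexp : ∀ A : Mat n, HasDerivAt (fun t : ℝ => NormedSpace.exp (t • A)) A 0 := by
      intro A
      have h := hasDerivAt_exp_smul_const (𝕂 := ℝ) A (0 : ℝ)
      rw [zero_smul, NormedSpace.exp_zero, one_mul] at h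
      exact h
    have hc : HasDerivAt (fun t : ℝ => NormedSpace.exp (t • (X : Mat n)) * (g : Mat n) *
        NormedSpace.exp (t • (Y : Mat n)))
        ((X : Mat n) * (g : Mat n) + (g : Mat n) * (Y : Mat n)) 0 := by
      have h := ((hexp X).mul_const (g : Mat n)).mul (hexp Y)
      rw [zero_smul, NormedSpace.exp_zero, zero_smul, NormedSpace.exp_zero, mul_one, one_mul] at h
      exact h
    have h0 : NormedSpace.exp ((0 : ℝ) • (X : Mat n)) * (g : Mat n) *
        NormedSpace.exp ((0 : ℝ) • (Y : Mat n)) = (g : Mat n) := by simp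
    have hcomp : HasDerivAt (fun t : ℝ => f (NormedSpace.exp (t • (X : Mat n)) * (g : Mat n) *
        NormedSpace.exp (t • (Y : Mat n))))
        (D ((X : Mat n) * (g : Mat n) + (g : Mat n) * (Y : Mat n))) 0 :=
      HasFDerivAt.comp_hasDerivAt (0 : ℝ) (by rw [h0]; exact hfd) hc
    rw [map_add] at hcomp
    refine hcomp.congr_of_eventuallyEq ?_
    have hmem : ∀ᶠ t in 𝓝 (0 : ℝ), NormedSpace.exp (t • (X : Mat n)) * (g : Mat n) *
        NormedSpace.exp (t • (Y : Mat n)) ∈ U :=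
      hc.continuousAt.eventually (by
        show ∀ᶠ y in 𝓝 (NormedSpace.exp ((0 : ℝ) • (X : Mat n)) * (g : Mat n) *
          NormedSpace.exp ((0 : ℝ) • (Y : Mat n))), y ∈ U
        rw [h0]; exact hU.mem_nhds hgU)
    filter_upwards [hmem] with t ht
    exact hφf (expSL (t • X) * g * expSL (t • Y)) ht
  have hrep : ∀ ℓ : Mat n →ₗ[ℝ] ℝ, ∃ Z : sl n, ∀ X : sl n, pairing (X : Mat n) Z = ℓ X := by
    intro ℓ
    let Z₀ : Mat n := Matrix.of fun j i =>
      (ℓ (Matrix.single i j Complex.I) : ℂ) + (ℓ (Matrix.single i j 1) : ℂ) * Complex.I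
    have hZ₀ : ∀ X : Mat n, pairing X Z₀ = ℓ X := by
      intro X
      conv_rhs => rw [Matrix.matrix_eq_sum_single X]
      simp only [pairing, Matrix.trace, Matrix.diag_apply, Matrix.mul_apply, Complex.im_sum,
        map_sum]
      refine Finset.sum_congr rfl fun i _ => Finset.sum_congr rfl fun j _ => ?_
      have hs : Matrix.single i j (X i j) = (X i j).re • (Matrix.single i j 1 : Mat n) +
          (X i j).im • (Matrix.single i j Complex.I : Mat n) := by
        rw [Matrix.smul_single, Matrix.smul_single, ← Matrix.single_add]
        congr 1
        apply Complex.ext <;> simp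
      rw [hs, map_add, map_smul, map_smul]
      simp [Z₀, Complex.mul_im]
    let c : ℂ := Z₀.trace / ((2 * n : ℕ) : ℂ)
    have htr : (Z₀ - c • (1 : Mat n)).trace = 0 := by
      rw [Matrix.trace_sub, Matrix.trace_smul, Matrix.trace_one, Fintype.card_fin, smul_eq_mul]
      rcases Nat.eq_zero_or_pos n with h | h
      · subst h
        simp [Matrix.trace]
      · have : ((2 * n : ℕ) : ℂ) ≠ 0 := by exact_mod_cast (by omega : 2 * n ≠ 0)
        simp only [c]
        rw [div_mul_cancel₀ _ this, sub_self]
    refine ⟨⟨Z₀ - c • (1 : Mat n), htr⟩, fun X => ?_⟩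
    have hXt : (X : Mat n).trace = 0 := X.2
    rw [← hZ₀ X]
    simp [pairing, Matrix.mul_sub, hXt]
  obtain ⟨Z, hZ⟩ := hrep (D.toLinearMap ∘ₗ LinearMap.mulRight ℝ (g : Mat n))
  obtain ⟨Z', hZ'⟩ := hrep (D.toLinearMap ∘ₗ LinearMap.mulLeft ℝ (g : Mat n))
  have hnd : ∀ A B : sl n, (∀ X : sl n, pairing (X : Mat n) A = pairing (X : Mat n) B) →
      A = B := by
    intro A B h
    have hA : (A : Mat n).trace = 0 := A.2
    have hB : (B : Mat n).trace = 0 := B.2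
    let C : Mat n := (A : Mat n) - (B : Mat n)
    have hC : (Complex.I • Cᴴ).trace = 0 := by
      rw [Matrix.trace_smul, Matrix.trace_conjTranspose, Matrix.trace_sub, hA, hB]
      simp
    have h1 : pairing (Complex.I • Cᴴ) C = 0 := by
      have h2 := h ⟨Complex.I • Cᴴ, hC⟩
      simp only [pairing] at h2 ⊢
      simp only [C, Matrix.mul_sub, Matrix.trace_sub, Complex.sub_im] at h2 ⊢
      exact sub_eq_zero.2 h2
    have h2 : (Cᴴ * C).trace = 0 := by
      have hre : (Cᴴ * C).trace.re = 0 := by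
        simpa [pairing, Matrix.smul_mul, Matrix.trace_smul, Complex.mul_im] using h1
      have him : (Cᴴ * C).trace.im = 0 := by
        have := congrArg Complex.im (Matrix.trace_conjTranspose (Cᴴ * C))
        rw [Matrix.conjTranspose_mul, Matrix.conjTranspose_conjTranspose] at this
        simp at this
        linarith
      exact Complex.ext hre him
    have h3 : C = 0 := Matrix.trace_conjTranspose_mul_self_eq_zero_iff.1 h2
    exact Subtype.ext (sub_eq_zero.1 h3)
  refine ⟨(Z, Z'), fun X Y => ?_, ?_⟩
  · rw [hZ X, hZ' Y]
    exact hder X Y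
  · rintro ⟨W, W'⟩ hW
    have h1 : ∀ X Y : sl n, pairing (X : Mat n) W + pairing (Y : Mat n) W' =
        pairing (X : Mat n) Z + pairing (Y : Mat n) Z' := by
      intro X Y
      have h2 := (hW X Y).unique (hder X Y)
      rw [hZ X, hZ' Y]
      exact h2
    have h0 : ∀ A : Mat n, pairing ((0 : sl n) : Mat n) A = 0 := by
      intro A; simp [pairing]
    refine Prod.ext (hnd _ _ fun X => ?_) (hnd _ _ fun X => ?_)
    · have := h1 X 0
      rwa [h0, h0, add_zero, add_zero] at this
    · have := h1 0 X
      rwa [h0, h0, zero_add, zero_add] at this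

open scoped Classical in
/-- The pair `(∇_g φ, ∇'_g φ)`, for functions that have it, in particular for smooth `φ`. -/
def gradients {n : ℕ} (φ : M n → ℝ) (g : M n) : sl n × sl n :=
  if h : ∃ Z : sl n × sl n, IsGradient φ g Z.1 Z.2 then h.choose else 0

/-- The left gradient `∇_g φ`. -/
def nabla {n : ℕ} (φ : M n → ℝ) (g : M n) : Mat n := (gradients φ g).1

/-- The right gradient `∇'_g φ`. -/
def nabla' {n : ℕ} (φ : M n → ℝ) (g : M n) : Mat n := (gradients φ g).2

/-- The Poisson bracket `{φ, ψ}` of the Heisenberg double. -/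
def bracket {n : ℕ} (φ ψ : M n → ℝ) (g : M n) : ℝ :=
  pairing (nabla φ g) (R (nabla ψ g)) + pairing (nabla' φ g) (R (nabla' ψ g))

/-! ### Hamiltonian vector fields, their components and flows -/

/-- `V` is the Hamiltonian vector field of `H`: at every point `V g` is tangent to `M`, and the
derivative of every smooth function `φ` along `V` is `{φ, H}`.  Tangent vectors of `M` at `g` are
the matrices `X g` with `X ∈ sl(2n, ℂ)`, being the velocity of `t ↦ e^{tX} g`. -/
def IsHamiltonianVectorField {n : ℕ} (H : M n → ℝ) (V : M n → Mat n) : Prop :=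
  ∀ g : M n, ∃ X : sl n, V g = (X : Mat n) * (g : Mat n) ∧
    ∀ φ : M n → ℝ, IsSmooth φ →
      HasDerivAt (fun t : ℝ => φ (expSL (t • X) * g)) (bracket φ H g) 0

/-- The tangent vector `v` of `M` at `g = k b` has the components `k̇ = κ` and `ḃ = β`: `κ` is
tangent to `K` at `k`, `β` is tangent to `B` at `b`, and `v = k̇ b + k ḃ`. -/
def HasComponents {n : ℕ} (g : M n) (v κ β : Mat n) : Prop :=
  (kPart g : Mat n)ᴴ * κ ∈ lieK n ∧
  β * ((bPart g)⁻¹ : M n) ∈ lieB n ∧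
  v = κ * (bPart g : Mat n) + (kPart g : Mat n) * β

/-- `V` generates a complete flow: there is a continuous one-parameter group of transformations
of `M`, defined for all times, whose orbits are integral curves of `V`, and every integral curve
of `V` is part of an orbit. -/
def GeneratesCompleteFlow {n : ℕ} (V : M n → Mat n) : Prop :=
  ∃ σ : Flow ℝ (M n),
    (∀ g : M n, ∀ t : ℝ, HasDerivAt (fun s : ℝ => (σ s g : Mat n)) (V (σ t g)) t) ∧
    ∀ (a b : ℝ) (γ : ℝ → M n), a < 0 → 0 < b →
      (∀ t ∈ Set.Ioo a b, HasDerivAt (fun s : ℝ => (γ s : Mat n)) (V (γ t)) t) →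
      ∀ t ∈ Set.Ioo a b, γ t = σ t (γ 0)

end HeisenbergDouble

end

namespace HeisenbergDouble

/-! Both families become tractable once the gradients are computed, because `R` acts as `1/2` on
Lie(K) and as `-1/2` on Lie(B), and a Hamiltonian vector field is `(R ∇H) g + g (R ∇'H)`
(`isHamiltonianVectorField_of_eq`).

For `F l`: since `g†g = b†b`, the traces of powers of `Ω` are those of `g†g`. Both gradients are `i`
times traceless parts of `(gg†)^l` and `(g†g)^l`, hence lie in Lie(K) (`nabla_F`), and they are
intertwined by `g`. The field is `g C` with `C` in Lie(K) commuting with `g†g`. So `g†g` is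
conserved, `C` is constant along the motion and the flow is `g exp(tC)`. Involution is the vanishing
of the real trace of a skew-Hermitian times a Hermitian matrix.

For `Phi l`: the function depends on `k` alone and is smooth because Gram-Schmidt is smooth
(`smoothExt_kPart_entry`). With `A = rotA`, `N = transN`, `Q = transQ`, its gradients are `-k N k†`
and `-b⁻¹ N b`, where `N` is supported in the upper right block and Lie(B) is isotropic for the
pairing (`nabla_Phi`). The central identity is `k (A + N) k† = Q` (`rotA_add_transN`), where `Q` is
again an upper right block. It splits the left gradient as `k A k† - Q` along Lie(K) + Lie(B), and
the field becomes `k̇ = k A`, `ḃ = N b`, or equivalently `ġ = Q g`. Involution follows from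
cyclicity of the trace, powers of `L` commuting with each other.

Completeness for `Phi l`: the equation for `k` is closed and lives on a compact set, so it can be
cut off to a bounded Lipschitz field with a global flow. Once `k(t)` is known, `ġ = Q g` is linear
with coefficients whose products all vanish, so its solution is exactly `(1 + ∫ Q) g`.

Invariance of `Phi l`: conjugation by `K₊` keeps `B` inside the block upper triangular matrices, and
a unitary matrix that is block upper triangular together with its inverse is block diagonal
(`kPart_mem_Kplus`). -/

/-! ### Global flows and one-parameter groups. -/

open scoped NNReal in
/-- A bounded Lipschitz vector field on a Banach space has a global continuous flow. -/
theorem exists_global_flow_of_lipschitz {E : Type*} [NormedAddCommGroup E] [NormedSpace ℝ E]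
    [CompleteSpace E] {w : E → E} {κ C : ℝ≥0} (hw : LipschitzWith κ w) (hC : ∀ x, ‖w x‖ ≤ C) :
    ∃ ψ : ℝ → E → E, Continuous (Function.uncurry ψ) ∧ (∀ x, ψ 0 x = x) ∧
      ∀ x t, HasDerivAt (fun s => ψ s x) (w (ψ t x)) t := by
  have hloc : ∀ N : ℕ, ∃ α : E × ℝ → E, (∀ x ∈ Metric.closedBall (0 : E) (N : ℝ≥0), α ⟨x, 0⟩ = x ∧
      ∀ t ∈ Set.Icc (-(N : ℝ)) N, HasDerivWithinAt (α ⟨x, ·⟩) (w (α ⟨x, t⟩))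
        (Set.Icc (-(N : ℝ)) N) t) ∧
      ContinuousOn α (Metric.closedBall (0 : E) (N : ℝ≥0) ×ˢ Set.Icc (-(N : ℝ)) N) := by
    intro N
    have h0 : (0 : ℝ) ∈ Set.Icc (-(N : ℝ)) N := by simp
    -- At speed at most `C`, a curve starting in the ball of radius `N` stays in the ball of radius
    -- `C * N + N` up to time `N`.
    refine IsPicardLindelof.exists_forall_mem_closedBall_eq_hasDerivWithinAt_continuousOn
      (f := fun _ => w) (t₀ := ⟨0, h0⟩) (a := C * N + N) (L := C) (K := κ) ?_
    exact IsPicardLindelof.of_time_independent (fun x _ => hC x) hw.lipschitzOnWith (by simp)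
  choose α hα hαc using hloc
  have hagree : ∀ (x : E) (N N' : ℕ), ‖x‖ ≤ N → ‖x‖ ≤ N' → ∀ t : ℝ, |t| < N → |t| < N' →
      α N (x, t) = α N' (x, t) := by
    have key : ∀ (x : E) (N N' : ℕ), ‖x‖ ≤ N → N ≤ N' → ∀ t : ℝ, |t| < N →
        α N (x, t) = α N' (x, t) := by
      intro x N N' hx hN t ht
      have hN' : (N : ℝ) ≤ N' := by exact_mod_cast hN
      have h1 := hα N x (by simpa using hx)
      have h2 := hα N' x (by simpa using hx.trans hN')
      have hpos : (0 : ℝ) < N := (abs_nonneg t).trans_lt ht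
      refine ODE_solution_unique_of_mem_Ioo (v := fun _ => w) (s := fun _ => Set.univ) (K := κ)
        (f := fun s => α N (x, s)) (g := fun s => α N' (x, s)) (a := -N) (b := N) (t₀ := 0)
        (fun _ _ => hw.lipschitzOnWith) ⟨by linarith, hpos⟩ (fun s hs => ⟨?_, trivial⟩)
        (fun s hs => ⟨?_, trivial⟩) (by rw [h1.1, h2.1]) (abs_lt.1 ht)
      · exact (h1.2 s (Set.Ioo_subset_Icc_self hs)).hasDerivAt (Icc_mem_nhds hs.1 hs.2)
      · have hs' : -(N' : ℝ) < s ∧ s < N' := ⟨by linarith [hs.1], by linarith [hs.2]⟩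
        exact (h2.2 s ⟨hs'.1.le, hs'.2.le⟩).hasDerivAt (Icc_mem_nhds hs'.1 hs'.2)
    intro x N N' hx hx' t ht ht'
    rcases le_total N N' with h | h
    · exact key x N N' hx h t ht
    · exact (key x N' N hx' h t ht').symm
  -- The index of a local flow valid at `(x, t)`. The inequality `|t| < ν x t` is strict so that `t`
  -- is interior to the time interval and one-sided derivatives become derivatives.
  let ν : E → ℝ → ℕ := fun x t => ⌈‖x‖⌉₊ + ⌈|t|⌉₊ + 1
  have hν1 : ∀ x t, ‖x‖ ≤ ν x t := fun x t => by
    have := Nat.le_ceil ‖x‖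
    have h2 : (0 : ℝ) ≤ ⌈|t|⌉₊ := by positivity
    simp only [ν]; push_cast; linarith
  have hν2 : ∀ x t, |t| < ν x t := fun x t => by
    have := Nat.le_ceil |t|
    have h2 : (0 : ℝ) ≤ ⌈‖x‖⌉₊ := by positivity
    simp only [ν]; push_cast; linarith
  have hψ : ∀ (x : E) (t : ℝ) (N : ℕ), ‖x‖ ≤ N → |t| < N → α (ν x t) (x, t) = α N (x, t) :=
    fun x t N hx ht => hagree x _ _ (hν1 x t) hx t (hν2 x t) ht
  refine ⟨fun t x => α (ν x t) (x, t), ?_, ?_, ?_⟩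
  · rw [continuous_iff_continuousAt]
    rintro ⟨t, x⟩
    -- The extra `1` makes the bound on `‖x‖` strict as well, hence valid on a neighbourhood, where
    -- a single local flow computes the global one.
    let N := ν x t + 1
    have hxN : ‖x‖ < N := by have := hν1 x t; simp only [N]; push_cast; linarith
    have htN : |t| < N := by have := hν2 x t; simp only [N]; push_cast; linarith
    have hev : ∀ᶠ p : ℝ × E in 𝓝 (t, x), ‖p.2‖ < N ∧ |p.1| < N :=
      ((continuous_snd.norm.tendsto (t, x)).eventually_lt_const hxN).and
        ((continuous_fst.abs.tendsto (t, x)).eventually_lt_const htN)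
    have hc : ContinuousAt (α N) (x, t) := (hαc N).continuousAt
      (prod_mem_nhds (by
        have : Metric.ball (0 : E) N ∈ 𝓝 x := Metric.isOpen_ball.mem_nhds (by simpa using hxN)
        exact Filter.mem_of_superset this (by simpa using Metric.ball_subset_closedBall))
        (Icc_mem_nhds (abs_lt.1 htN).1 (abs_lt.1 htN).2))
    have hc' : ContinuousAt (fun p : ℝ × E => α N (p.2, p.1)) (t, x) :=
      ContinuousAt.comp (f := fun p : ℝ × E => (p.2, p.1)) hc (by fun_prop)
    refine hc'.congr ?_
    filter_upwards [hev] with p hp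
    exact (hψ p.2 p.1 N hp.1.le hp.2).symm
  · intro x
    exact (hα _ x (by simpa using hν1 x 0)).1
  · intro x t
    let N := ν x t
    have htN : |t| < N := hν2 x t
    have h1 := (hα N x (by simpa using hν1 x t)).2 t ⟨(abs_lt.1 htN).1.le, (abs_lt.1 htN).2.le⟩
    refine (h1.hasDerivAt (Icc_mem_nhds (abs_lt.1 htN).1 (abs_lt.1 htN).2)).congr_of_eventuallyEq ?_
    have hev : ∀ᶠ s : ℝ in 𝓝 t, |s| < N := (isOpen_lt (by fun_prop) continuous_const).mem_nhds htN
    filter_upwards [hev] with s hs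
    exact hψ x s N (hν1 x t) hs

/-- A jointly continuous family of integral curves to which every integral curve belongs is
a complete flow. -/
theorem generatesCompleteFlow_of_integralCurves {n : ℕ} {V : M n → Mat n} (σ : ℝ → M n → M n)
    (hc : Continuous (Function.uncurry σ)) (h0 : ∀ g, σ 0 g = g)
    (hd : ∀ g t, HasDerivAt (fun s : ℝ => (σ s g : Mat n)) (V (σ t g)) t)
    (hu : ∀ (a b : ℝ) (γ : ℝ → M n), a < 0 → 0 < b →
      (∀ t ∈ Set.Ioo a b, HasDerivAt (fun s : ℝ => (γ s : Mat n)) (V (γ t)) t) →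
      ∀ t ∈ Set.Ioo a b, γ t = σ t (γ 0)) :
    GeneratesCompleteFlow V := by
  refine ⟨⟨σ, hc, fun s t g => ?_, h0⟩, hd, hu⟩
  -- The group law is uniqueness applied to the time-shifted orbit, an integral curve starting at `σ
  -- t g`; the interval is any one containing `0` and `s`.
  have h := hu (-(|s| + 1)) (|s| + 1) (fun r => σ (r + t) g) (by linarith [abs_nonneg s])
    (by linarith [abs_nonneg s]) (fun r _ => (hd g (r + t)).comp_add_const r t)
    s ⟨by linarith [neg_abs_le s], by linarith [le_abs_self s]⟩
  simpa using h

/-! ### Matrix identities for the factors -/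

theorem coe_mul_coe_inv {n : ℕ} (a : M n) : (a : Mat n) * ((a⁻¹ : M n) : Mat n) = 1 := by
  rw [← Matrix.SpecialLinearGroup.coe_mul, mul_inv_cancel, Matrix.SpecialLinearGroup.coe_one]

theorem coe_inv_mul_coe {n : ℕ} (a : M n) : ((a⁻¹ : M n) : Mat n) * (a : Mat n) = 1 := by
  rw [← Matrix.SpecialLinearGroup.coe_mul, inv_mul_cancel, Matrix.SpecialLinearGroup.coe_one]

theorem conjTranspose_mul_self_of_mem_K {n : ℕ} {k : M n} (hk : k ∈ K n) :
    (k : Mat n)ᴴ * (k : Mat n) = 1 := hk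

theorem mul_conjTranspose_self_of_mem_K {n : ℕ} {k : M n} (hk : k ∈ K n) :
    (k : Mat n) * (k : Mat n)ᴴ = 1 := mul_eq_one_comm.mp hk

theorem coe_inv_of_mem_K {n : ℕ} {k : M n} (hk : k ∈ K n) :
    ((k⁻¹ : M n) : Mat n) = (k : Mat n)ᴴ := by
  calc ((k⁻¹ : M n) : Mat n) = (k : Mat n)ᴴ * (k : Mat n) * ((k⁻¹ : M n) : Mat n) := by
        rw [conjTranspose_mul_self_of_mem_K hk, Matrix.one_mul]
    _ = _ := by rw [Matrix.mul_assoc, coe_mul_coe_inv, Matrix.mul_one]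

theorem coe_kPart_mul_coe_bPart {n : ℕ} (g : M n) :
    (kPart g : Mat n) * (bPart g : Mat n) = (g : Mat n) := by
  rw [← Matrix.SpecialLinearGroup.coe_mul, kPart_mul_bPart]

theorem coe_bPart_eq {n : ℕ} (g : M n) :
    (bPart g : Mat n) = (kPart g : Mat n)ᴴ * (g : Mat n) := by
  rw [← coe_kPart_mul_coe_bPart g, ← Matrix.mul_assoc,
    conjTranspose_mul_self_of_mem_K (kPart_mem g), Matrix.one_mul]

theorem parts_eq {n : ℕ} {k b : M n} (hk : k ∈ K n) (hb : b ∈ B n) :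
    kPart (k * b) = k ∧ bPart (k * b) = b := by
  have h := (existsUnique_KB (k * b)).unique
    (y₁ := (kPart (k * b), bPart (k * b))) (y₂ := (k, b))
    ⟨kPart_mem _, bPart_mem _, kPart_mul_bPart _⟩ ⟨hk, hb, rfl⟩
  exact ⟨congrArg Prod.fst h, congrArg Prod.snd h⟩

/-- Upper triangular matrices with real diagonal. -/
def IsUpperReal {n : ℕ} (X : Mat n) : Prop :=
  (∀ i j, j < i → X i j = 0) ∧ ∀ i, (X i i).im = 0

theorem IsUpperReal.sub {n : ℕ} {X Y : Mat n} (hX : IsUpperReal X) (hY : IsUpperReal Y) :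
    IsUpperReal (X - Y) :=
  ⟨fun i j h => by rw [Matrix.sub_apply, hX.1 i j h, hY.1 i j h, sub_zero],
    fun i => by rw [Matrix.sub_apply, Complex.sub_im, hX.2 i, hY.2 i, sub_zero]⟩

theorem IsUpperReal.mul {n : ℕ} {X Y : Mat n} (hX : IsUpperReal X) (hY : IsUpperReal Y) :
    IsUpperReal (X * Y) := by
  have h : ∀ i j, j ≤ i → (X * Y) i j = X i i * Y i j := fun i j hij => by
    rw [Matrix.mul_apply, Finset.sum_eq_single i (fun x _ hx => ?_) (by simp)]
    rcases lt_or_gt_of_ne hx with h | h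
    · rw [hX.1 i x h, zero_mul]
    · rw [hY.1 x j (hij.trans_lt h), mul_zero]
  refine ⟨fun i j hij => ?_, fun i => ?_⟩
  · rw [h i j hij.le, hY.1 i j hij, mul_zero]
  · rw [h i i le_rfl, Complex.mul_im, hX.2 i, hY.2 i, mul_zero, zero_mul, add_zero]

/-- Together with `IsUpperReal.mul` this is the isotropy of Lie(B) for the pairing. -/
theorem IsUpperReal.trace_im {n : ℕ} {X : Mat n} (hX : IsUpperReal X) : X.trace.im = 0 := by
  rw [Matrix.trace, Complex.im_sum]
  exact Finset.sum_eq_zero fun i _ => hX.2 i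

theorem isUpperReal_of_mem_B {n : ℕ} {b : M n} (hb : b ∈ B n) : IsUpperReal (b : Mat n) :=
  ⟨hb.1, fun i => (hb.2 i).2⟩

theorem mem_lieB_iff {n : ℕ} {X : Mat n} : X ∈ lieB n ↔ IsUpperReal X ∧ X.trace = 0 := by
  simp only [lieB, IsUpperReal, Set.mem_ofPred_eq, and_assoc]

/-- The infinitesimal counterpart of `K_inf_B`; it makes the velocities of the two factors unique.
-/
theorem IsUpperReal.eq_zero_of_skew {n : ℕ} {X : Mat n} (hX : IsUpperReal X) (hs : Xᴴ = -X) :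
    X = 0 := by
  have h : ∀ i j, star (X j i) = - X i j := fun i j => by
    rw [← conjTranspose_apply, hs, Matrix.neg_apply]
  ext i j
  rcases lt_trichotomy i j with hij | hij | hij
  · have := h i j
    rw [hX.1 j i hij, star_zero] at this
    simpa using this.symm
  · subst hij
    have := congrArg Complex.re (h i i)
    simp at this
    exact Complex.ext (by simpa using by linarith) (hX.2 i)
  · exact hX.1 i j hij

/-! ### Functions on `SL(2n, ℂ)` with a smooth extension to a neighbourhood -/

/-- `φ` is the restriction of a smooth function on an open neighbourhood of `SL(2n, ℂ)`. -/
def SmoothExt {n : ℕ} {E : Type*} [NormedAddCommGroup E] [NormedSpace ℝ E] (φ : M n → E) : Prop :=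
  ∃ (U : Set (Mat n)) (f : Mat n → E), IsOpen U ∧ (∀ h : M n, (h : Mat n) ∈ U) ∧
    ContDiffOn ℝ ∞ f U ∧ ∀ h : M n, φ h = f h

section SmoothExt

variable {n : ℕ} {E F G : Type*} [NormedAddCommGroup E] [NormedSpace ℝ E]
  [NormedAddCommGroup F] [NormedSpace ℝ F] [NormedAddCommGroup G] [NormedSpace ℝ G]

theorem SmoothExt.coe : SmoothExt (fun g : M n => (g : Mat n)) :=
  ⟨Set.univ, id, isOpen_univ, fun _ => trivial, contDiffOn_id, fun _ => rfl⟩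

theorem SmoothExt.const (c : E) : SmoothExt (fun _ : M n => c) :=
  ⟨Set.univ, fun _ => c, isOpen_univ, fun _ => trivial, contDiffOn_const, fun _ => rfl⟩

/-- The restriction to an open `V` serves the inverse square root, which is smooth on positive
numbers only; the neighbourhood of the group shrinks to the preimage of `V`. -/
theorem SmoothExt.comp_on {φ : M n → E} (hφ : SmoothExt φ) {H : E → F} {V : Set E}
    (hV : IsOpen V) (hH : ContDiffOn ℝ ∞ H V) (hm : ∀ g, φ g ∈ V) :
    SmoothExt (fun g => H (φ g)) := by
  obtain ⟨U, f, hU, hmU, hf, he⟩ := hφ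
  refine ⟨U ∩ f ⁻¹' V, H ∘ f, hf.continuousOn.isOpen_inter_preimage hU hV,
    fun g => ⟨hmU g, ?_⟩, hH.comp (hf.mono Set.inter_subset_left) fun x hx => hx.2, fun g => ?_⟩
  · rw [Set.mem_preimage, ← he]; exact hm g
  · exact congrArg H (he g)

theorem SmoothExt.comp {φ : M n → E} (hφ : SmoothExt φ) {H : E → F} (hH : ContDiff ℝ ∞ H) :
    SmoothExt (fun g => H (φ g)) :=
  hφ.comp_on isOpen_univ hH.contDiffOn fun _ => trivial

theorem SmoothExt.linear [FiniteDimensional ℝ E] {φ : M n → E} (hφ : SmoothExt φ)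
    (H : E →ₗ[ℝ] F) : SmoothExt (fun g => H (φ g)) :=
  hφ.comp H.toContinuousLinearMap.contDiff

theorem SmoothExt.comp₂ {φ : M n → E} {ψ : M n → F} (hφ : SmoothExt φ) (hψ : SmoothExt ψ)
    {H : E × F → G} (hH : ContDiff ℝ ∞ H) : SmoothExt (fun g => H (φ g, ψ g)) := by
  obtain ⟨U, f, hU, hmU, hf, he⟩ := hφ
  obtain ⟨U', f', hU', hmU', hf', he'⟩ := hψ
  refine SmoothExt.comp (φ := fun g => (φ g, ψ g)) ⟨U ∩ U', fun x => (f x, f' x), hU.inter hU',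
    fun g => ⟨hmU g, hmU' g⟩, (hf.mono Set.inter_subset_left).prodMk
      (hf'.mono Set.inter_subset_right), fun g => Prod.ext (he g) (he' g)⟩ hH

theorem SmoothExt.add {φ ψ : M n → E} (hφ : SmoothExt φ) (hψ : SmoothExt ψ) :
    SmoothExt (fun g => φ g + ψ g) := hφ.comp₂ hψ contDiff_add

theorem SmoothExt.sub {φ ψ : M n → E} (hφ : SmoothExt φ) (hψ : SmoothExt ψ) :
    SmoothExt (fun g => φ g - ψ g) :=
  hφ.comp₂ hψ (H := fun p : E × E => p.1 - p.2) (contDiff_fst.sub contDiff_snd)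

theorem SmoothExt.mul {A : Type*} [NormedRing A] [NormedAlgebra ℝ A] {φ ψ : M n → A}
    (hφ : SmoothExt φ) (hψ : SmoothExt ψ) :
    SmoothExt (fun g => φ g * ψ g) := hφ.comp₂ hψ contDiff_mul

theorem SmoothExt.pow {A : Type*} [NormedRing A] [NormedAlgebra ℝ A] {φ : M n → A}
    (hφ : SmoothExt φ) (l : ℕ) : SmoothExt (fun g => φ g ^ l) := by
  induction l with
  | zero => simpa using SmoothExt.const (1 : A)
  | succ l ih => simpa only [pow_succ] using ih.mul hφ

theorem SmoothExt.sum {ι : Type*} (s : Finset ι) {φ : ι → M n → E}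
    (hφ : ∀ i ∈ s, SmoothExt (φ i)) : SmoothExt (fun g => ∑ i ∈ s, φ i g) := by
  classical
  induction s using Finset.induction_on with
  | empty => simpa using SmoothExt.const (0 : E)
  | insert a s ha ih =>
    simp only [Finset.sum_insert ha]
    exact (hφ a (by simp)).add (ih fun i hi => hφ i (by simp [hi]))

theorem SmoothExt.entry {φ : M n → Mat n} (hφ : SmoothExt φ) (i j : Fin (2 * n)) :
    SmoothExt (fun g => φ g i j) :=
  hφ.linear (Matrix.entryLinearMap ℝ ℂ i j)

theorem SmoothExt.of_entries {φ : M n → Mat n} (hφ : ∀ i j, SmoothExt (fun g => φ g i j)) :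
    SmoothExt φ := by
  have h : φ = fun g => ∑ i, ∑ j, Matrix.single i j (φ g i j) :=
    funext fun g => Matrix.matrix_eq_sum_single (φ g)
  rw [h]
  exact SmoothExt.sum _ fun i _ => SmoothExt.sum _ fun j _ =>
    (hφ i j).linear (Matrix.singleLinearMap ℝ i j)

theorem SmoothExt.star {φ : M n → ℂ} (hφ : SmoothExt φ) : SmoothExt (fun g => star (φ g)) :=
  hφ.comp Complex.conjCLE.contDiff

theorem SmoothExt.conjTranspose {φ : M n → Mat n} (hφ : SmoothExt φ) :
    SmoothExt (fun g => (φ g)ᴴ) :=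
  SmoothExt.of_entries fun i j => (hφ.entry j i).star

theorem SmoothExt.re {φ : M n → ℂ} (hφ : SmoothExt φ) : SmoothExt (fun g => (φ g).re) :=
  hφ.comp Complex.reCLM.contDiff

theorem SmoothExt.trace {φ : M n → Mat n} (hφ : SmoothExt φ) :
    SmoothExt (fun g => (φ g).trace) :=
  hφ.linear (Matrix.traceLinearMap (Fin (2 * n)) ℝ ℂ)

theorem SmoothExt.isSmooth {φ : M n → ℝ} (hφ : SmoothExt φ) : IsSmooth φ := by
  obtain ⟨U, f, hU, hmU, hf, he⟩ := hφ
  exact fun g => ⟨U, hU, hmU g, f, hf, fun h _ => he h⟩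

theorem SmoothExt.continuous {φ : M n → E} (hφ : SmoothExt φ) : Continuous φ := by
  obtain ⟨U, f, hU, hmU, hf, he⟩ := hφ
  have h : Continuous fun g : M n => f (g : Mat n) :=
    hf.continuousOn.comp_continuous continuous_subtype_val hmU
  exact h.congr fun g => (he g).symm

theorem SmoothExt.differentiableAt_comp {φ : M n → E} (hφ : SmoothExt φ) {γ : ℝ → M n}
    {v : Mat n} {t : ℝ} (hγ : HasDerivAt (fun s => (γ s : Mat n)) v t) :
    DifferentiableAt ℝ (fun s => φ (γ s)) t := by
  obtain ⟨U, f, hU, hmU, hf, he⟩ := hφ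
  simp only [he]
  exact DifferentiableAt.comp t (f := fun s => (γ s : Mat n)) (g := f)
    ((hf.contDiffAt (hU.mem_nhds (hmU _))).differentiableAt (by simp)) hγ.differentiableAt

end SmoothExt

/-- The derivative of a smooth function along curves. -/
theorem IsSmooth.exists_fderiv {n : ℕ} {φ : M n → ℝ} (hφ : IsSmooth φ) (g : M n) :
    ∃ D : Mat n →L[ℝ] ℝ, ∀ (γ : ℝ → M n) (v : Mat n) (t : ℝ), γ t = g →
      HasDerivAt (fun s => (γ s : Mat n)) v t → HasDerivAt (fun s => φ (γ s)) (D v) t := by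
  obtain ⟨U, hU, hgU, f, hf, hφf⟩ := hφ g
  refine ⟨fderiv ℝ f (g : Mat n), fun γ v t hg hγ => ?_⟩
  subst hg
  have hfd : HasFDerivAt f (fderiv ℝ f (γ t : Mat n)) (γ t : Mat n) :=
    ((hf.contDiffAt (hU.mem_nhds hgU)).differentiableAt (by simp)).hasFDerivAt
  refine (HasFDerivAt.comp_hasDerivAt t hfd hγ).congr_of_eventuallyEq ?_
  filter_upwards [hγ.continuousAt.eventually (hU.mem_nhds hgU)] with s hs
  exact hφf _ hs

/-! ### Smoothness of the factors -/

/-- Gram-Schmidt, by strong induction on the column `j`. The earlier columns of `k` give the entries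
of `b` above the diagonal in column `j`; subtracting their contribution from column `j` of `g`
leaves `b j j` times column `j` of `k`. That column being a unit vector, the squared norm of the
remainder is `(b j j)²`, and positivity of `b j j` allows a smooth square root and division. -/
theorem smoothExt_kPart_entry {n : ℕ} (j : Fin (2 * n)) :
    ∀ i, SmoothExt (fun g : M n => (kPart g : Mat n) i j) := by
  induction j using WellFoundedLT.induction with
  | _ j ih =>
  have hg := fun i => (SmoothExt.coe (n := n)).entry i j
  have hb : ∀ m, m < j → SmoothExt (fun g : M n => (bPart g : Mat n) m j) := fun m hm => by
    simp only [coe_bPart_eq, Matrix.mul_apply, conjTranspose_apply]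
    exact SmoothExt.sum _ fun p _ => (ih m hm p).star.mul (hg p)
  have hu : ∀ i, SmoothExt (fun g : M n => (kPart g : Mat n) i j * (bPart g : Mat n) j j) := by
    intro i
    have h : (fun g : M n => (kPart g : Mat n) i j * (bPart g : Mat n) j j) = fun g : M n =>
        (g : Mat n) i j - ∑ m ∈ Finset.Iio j, (kPart g : Mat n) i m * (bPart g : Mat n) m j := by
      funext g
      have h1 : (g : Mat n) i j = ∑ m, (kPart g : Mat n) i m * (bPart g : Mat n) m j := by
        rw [← Matrix.mul_apply, coe_kPart_mul_coe_bPart]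
      have h2 : ∑ m, (kPart g : Mat n) i m * (bPart g : Mat n) m j =
          ∑ m ∈ Finset.Iic j, (kPart g : Mat n) i m * (bPart g : Mat n) m j := by
        refine (Finset.sum_subset (Finset.subset_univ _) fun m _ hm => ?_).symm
        rw [Finset.mem_Iic, not_le] at hm
        rw [(bPart_mem g).1 m j hm, mul_zero]
      rw [h1, h2, ← Finset.Iio_insert, Finset.sum_insert (by simp), add_sub_cancel_right]
    rw [h]
    exact (hg i).sub (SmoothExt.sum _ fun m hm =>
      (ih m (Finset.mem_Iio.1 hm) i).mul (hb m (Finset.mem_Iio.1 hm)))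
  have hre : ∀ g : M n, 0 < ((bPart g : Mat n) j j).re := fun g => ((bPart_mem g).2 j).1
  have hbr : ∀ g : M n, (bPart g : Mat n) j j = (((bPart g : Mat n) j j).re : ℂ) := fun g =>
    Complex.ext rfl (by simpa using ((bPart_mem g).2 j).2)
  have hsq : SmoothExt (fun g : M n => ((bPart g : Mat n) j j).re ^ 2) := by
    have h : (fun g : M n => ((bPart g : Mat n) j j).re ^ 2) = fun g : M n =>
        (∑ i, star ((kPart g : Mat n) i j * (bPart g : Mat n) j j) *
          ((kPart g : Mat n) i j * (bPart g : Mat n) j j)).re := by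
      funext g
      have h1 : ∑ i, star ((kPart g : Mat n) i j) * (kPart g : Mat n) i j = 1 := by
        have := congrFun (congrFun (conjTranspose_mul_self_of_mem_K (kPart_mem g)) j) j
        rwa [Matrix.mul_apply, Matrix.one_apply_eq] at this
      have h2 : ∀ i, star ((kPart g : Mat n) i j * (bPart g : Mat n) j j) *
          ((kPart g : Mat n) i j * (bPart g : Mat n) j j) =
          (star ((kPart g : Mat n) i j) * (kPart g : Mat n) i j) *
            ((((bPart g : Mat n) j j).re ^ 2 : ℝ) : ℂ) := fun i => by
        rw [hbr g, star_mul']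
        simp only [Complex.ofReal_re, RCLike.star_def, Complex.conj_ofReal, Complex.ofReal_pow]
        ring
      simp only [h2]
      rw [← Finset.sum_mul, h1, one_mul, Complex.ofReal_re]
    rw [h]
    exact (SmoothExt.sum _ fun i _ => (hu i).star.mul (hu i)).re
  have hinv : SmoothExt (fun g : M n => ((((bPart g : Mat n) j j).re)⁻¹ : ℂ)) := by
    have h := (hsq.comp_on (H := fun x => (((Real.sqrt x)⁻¹ : ℝ) : ℂ)) isOpen_Ioi
      (V := Set.Ioi 0) ?_ fun g => pow_pos (hre g) 2)
    · simpa only [Real.sqrt_sq (hre _).le, Complex.ofReal_inv] using h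
    · refine Complex.ofRealCLM.contDiff.comp_contDiffOn (f := fun x : ℝ => (Real.sqrt x)⁻¹) ?_
      intro x hx
      have hx' : 0 < x := hx
      exact ((Real.contDiffAt_sqrt hx'.ne').inv (Real.sqrt_pos.2 hx').ne').contDiffWithinAt
  intro i
  have h : (fun g : M n => (kPart g : Mat n) i j) = fun g : M n =>
      ((kPart g : Mat n) i j * (bPart g : Mat n) j j) * ((((bPart g : Mat n) j j).re)⁻¹ : ℂ) := by
    funext g
    rw [← hbr g, mul_assoc, mul_inv_cancel₀, mul_one]
    rw [hbr g]
    exact_mod_cast (hre g).ne'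
  rw [h]
  exact (hu i).mul hinv

theorem smoothExt_kPart {n : ℕ} : SmoothExt (fun g : M n => (kPart g : Mat n)) :=
  SmoothExt.of_entries fun i j => smoothExt_kPart_entry j i

theorem smoothExt_bPart {n : ℕ} : SmoothExt (fun g : M n => (bPart g : Mat n)) := by
  simp only [coe_bPart_eq]
  exact smoothExt_kPart.conjTranspose.mul SmoothExt.coe

/-! ### Derivatives of the factors along curves -/

theorem hasDerivAt_linear {E F : Type*} [NormedAddCommGroup E] [NormedSpace ℝ E]
    [NormedAddCommGroup F] [NormedSpace ℝ F] [FiniteDimensional ℝ E] (ℓ : E →ₗ[ℝ] F) {f : ℝ → E}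
    {f' : E} {t : ℝ} (hf : HasDerivAt f f' t) : HasDerivAt (fun s => ℓ (f s)) (ℓ f') t :=
  ℓ.toContinuousLinearMap.hasFDerivAt.comp_hasDerivAt t hf

theorem hasDerivAt_entry {n : ℕ} {f : ℝ → Mat n} {f' : Mat n} {t : ℝ} (hf : HasDerivAt f f' t)
    (i j : Fin (2 * n)) : HasDerivAt (fun s => f s i j) (f' i j) t :=
  hasDerivAt_linear (Matrix.entryLinearMap ℝ ℂ i j) hf

theorem hasDerivAt_matrix_mul {n : ℕ} {f h : ℝ → Mat n} {f' h' : Mat n} {t : ℝ}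
    (hf : HasDerivAt f f' t) (hh : HasDerivAt h h' t) :
    HasDerivAt (fun s => f s * h s) (f' * h t + f t * h') t := hf.mul hh

theorem hasDerivAt_conjTranspose {n : ℕ} {f : ℝ → Mat n} {f' : Mat n} {t : ℝ}
    (hf : HasDerivAt f f' t) : HasDerivAt (fun s => (f s)ᴴ) f'ᴴ t :=
  hasDerivAt_linear (Matrix.conjTransposeLinearEquiv (Fin (2 * n)) (Fin (2 * n)) ℝ ℂ).toLinearMap hf

theorem hasDerivAt_trace {n : ℕ} {f : ℝ → Mat n} {f' : Mat n} {t : ℝ}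
    (hf : HasDerivAt f f' t) : HasDerivAt (fun s => (f s).trace) f'.trace t :=
  hasDerivAt_linear (Matrix.traceLinearMap (Fin (2 * n)) ℝ ℂ) hf

theorem hasDerivAt_re {f : ℝ → ℂ} {f' : ℂ} {t : ℝ} (hf : HasDerivAt f f' t) :
    HasDerivAt (fun s => (f s).re) f'.re t :=
  Complex.reCLM.hasFDerivAt.comp_hasDerivAt t hf

theorem hasDerivAt_im {f : ℝ → ℂ} {f' : ℂ} {t : ℝ} (hf : HasDerivAt f f' t) :
    HasDerivAt (fun s => (f s).im) f'.im t :=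
  Complex.imCLM.hasFDerivAt.comp_hasDerivAt t hf

/-- Along a curve whose velocity has the components `κ` and `β`, these are the velocities
of the two factors. -/
theorem HasComponents.hasDerivAt {n : ℕ} {γ : ℝ → M n} {v κ β : Mat n} {t : ℝ}
    (hc : HasComponents (γ t) v κ β) (hγ : HasDerivAt (fun s => (γ s : Mat n)) v t) :
    HasDerivAt (fun s => (kPart (γ s) : Mat n)) κ t ∧
      HasDerivAt (fun s => (bPart (γ s) : Mat n)) β t := by
  obtain ⟨⟨hκ, -⟩, hβ, hv⟩ := hc
  have hβ := (mem_lieB_iff.1 hβ).1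
  set k := (kPart (γ t) : Mat n) with hk
  set b := (bPart (γ t) : Mat n) with hb
  set c := (((bPart (γ t))⁻¹ : M n) : Mat n) with hcdef
  have hkk : kᴴ * k = 1 := conjTranspose_mul_self_of_mem_K (kPart_mem _)
  have hkk' : k * kᴴ = 1 := mul_conjTranspose_self_of_mem_K (kPart_mem _)
  have hbc : b * c = 1 := coe_mul_coe_inv _
  have hcb : c * b = 1 := coe_inv_mul_coe _
  -- Differentiability of the factors is known from smoothness; only the values `k'` and `b'` remain
  -- to be identified.
  have h1 := (smoothExt_kPart.differentiableAt_comp hγ).hasDerivAt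
  have h2 := (smoothExt_bPart.differentiableAt_comp hγ).hasDerivAt
  set k' := deriv (fun s => (kPart (γ s) : Mat n)) t
  set b' := deriv (fun s => (bPart (γ s) : Mat n)) t
  have h3 : k' * b + k * b' = κ * b + k * β := by
    have h := hasDerivAt_matrix_mul h1 h2
    simp only [coe_kPart_mul_coe_bPart] at h
    rw [← hv]
    exact h.unique hγ
  have h4 : k'ᴴ * k + kᴴ * k' = 0 := by
    have h := hasDerivAt_matrix_mul (hasDerivAt_conjTranspose h1) h1
    simp only [conjTranspose_mul_self_of_mem_K (kPart_mem _)] at h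
    exact h.unique (hasDerivAt_const t (1 : Mat n))
  have h5 : IsUpperReal b' := by
    refine ⟨fun i j hij => ?_, fun i => ?_⟩
    · refine (hasDerivAt_entry h2 i j).unique ?_
      simp only [(bPart_mem _).1 i j hij]
      exact hasDerivAt_const _ _
    · refine (hasDerivAt_im (hasDerivAt_entry h2 i i)).unique ?_
      simp only [((bPart_mem _).2 i).2]
      exact hasDerivAt_const _ _
  have hc' : IsUpperReal c := isUpperReal_of_mem_B ((B n).inv_mem (bPart_mem _))
  -- The two product rules, multiplied by `k†` on the left and `b⁻¹` on the right: the left side is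
  -- skew-Hermitian, the right side upper triangular with real diagonal, so both vanish.
  have h6 : kᴴ * (k' - κ) = β * c - b' * c := by
    have h := congrArg (fun Z => kᴴ * Z * c) h3
    simp only [Matrix.mul_add, Matrix.add_mul, Matrix.mul_assoc, hbc, Matrix.mul_one] at h
    simp only [← Matrix.mul_assoc kᴴ k, hkk, Matrix.one_mul] at h
    rw [Matrix.mul_sub, sub_eq_sub_iff_add_eq_add, h, add_comm]
  have h7 : kᴴ * (k' - κ) = 0 := by
    refine IsUpperReal.eq_zero_of_skew (h6 ▸ hβ.sub (h5.mul hc')) ?_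
    have h8 : (kᴴ * k')ᴴ = -(kᴴ * k') := by
      rw [conjTranspose_mul, conjTranspose_conjTranspose]
      exact eq_neg_of_add_eq_zero_left h4
    rw [Matrix.mul_sub, conjTranspose_sub, h8, hκ]
    abel
  have h8 : k' = κ := by
    have h := congrArg (fun Z => k * Z) h7
    simp only [← Matrix.mul_assoc, hkk', Matrix.one_mul, Matrix.mul_zero] at h
    exact sub_eq_zero.1 h
  have h9 : b' = β := by
    rw [h8, add_right_inj] at h3
    have h := congrArg (fun Z => kᴴ * Z) h3
    simpa only [← Matrix.mul_assoc, hkk, Matrix.one_mul] using h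
  exact ⟨h8 ▸ h1, h9 ▸ h2⟩

/-! ### Gradients and Hamiltonian vector fields -/

theorem pairing_comm {n : ℕ} (X Y : Mat n) : pairing X Y = pairing Y X := by
  rw [pairing, pairing, Matrix.trace_mul_comm]

theorem R_add {n : ℕ} {Y Z : Mat n} (hY : Y ∈ lieK n) (hZ : Z ∈ lieB n) :
    R (Y + Z) = (1 / 2 : ℝ) • (Y - Z) := by
  have hX : Y + Z ∈ sl n := by
    rw [mem_sl, Matrix.trace_add, hY.2, hZ.2.2, add_zero]
  obtain ⟨h1, h2⟩ := (proj_unique hX Y Z).1 ⟨hY, hZ, rfl⟩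
  rw [R, ← h1, ← h2]

theorem zero_mem_lieK {n : ℕ} : (0 : Mat n) ∈ lieK n := by simp [lieK]

theorem zero_mem_lieB {n : ℕ} : (0 : Mat n) ∈ lieB n := by simp [lieB]

theorem R_of_mem_lieK {n : ℕ} {Y : Mat n} (hY : Y ∈ lieK n) : R Y = (1 / 2 : ℝ) • Y := by
  simpa using R_add hY zero_mem_lieB

theorem R_of_mem_lieB {n : ℕ} {Z : Mat n} (hZ : Z ∈ lieB n) : R Z = -((1 / 2 : ℝ) • Z) := by
  simpa using R_add zero_mem_lieK hZ

theorem proj_mem {n : ℕ} {X : Mat n} (hX : X ∈ sl n) :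
    projK X ∈ lieK n ∧ projB X ∈ lieB n ∧ X = projK X + projB X :=
  (proj_unique hX (projK X) (projB X)).2 ⟨rfl, rfl⟩

theorem R_mem_sl {n : ℕ} {X : Mat n} (hX : X ∈ sl n) : R X ∈ sl n := by
  obtain ⟨h1, h2, -⟩ := proj_mem hX
  exact Submodule.smul_mem _ _ (Submodule.sub_mem _ h1.2 h2.2.2)

theorem expSL_zero {n : ℕ} : expSL (0 : sl n) = 1 := by
  apply Subtype.ext
  simp [expSL]

theorem hasDerivAt_expSL {n : ℕ} (X : sl n) :
    HasDerivAt (fun t : ℝ => (expSL (t • X) : Mat n)) (X : Mat n) 0 := by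
  have h := hasDerivAt_exp_smul_const (𝕂 := ℝ) (X : Mat n) (0 : ℝ)
  rw [zero_smul, NormedSpace.exp_zero, one_mul] at h
  exact h

theorem hasDerivAt_expSL_mul_expSL {n : ℕ} (g : M n) (X Y : sl n) :
    HasDerivAt (fun t : ℝ => ((expSL (t • X) * g * expSL (t • Y) : M n) : Mat n))
      ((X : Mat n) * (g : Mat n) + (g : Mat n) * (Y : Mat n)) 0 := by
  have h := hasDerivAt_matrix_mul
    (hasDerivAt_matrix_mul (hasDerivAt_expSL X) (hasDerivAt_const (0 : ℝ) (g : Mat n)))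
    (hasDerivAt_expSL Y)
  simpa [expSL_zero] using h

theorem hasDerivAt_expSL_mul {n : ℕ} (g : M n) (X : sl n) :
    HasDerivAt (fun t : ℝ => ((expSL (t • X) * g : M n) : Mat n)) ((X : Mat n) * (g : Mat n)) 0 := by
  have h := hasDerivAt_matrix_mul (hasDerivAt_expSL X) (hasDerivAt_const (0 : ℝ) (g : Mat n))
  simpa using h

theorem isGradient_gradients {n : ℕ} {φ : M n → ℝ} (hφ : IsSmooth φ) (g : M n) :
    IsGradient φ g (gradients φ g).1 (gradients φ g).2 := by
  have h : ∃ Z : sl n × sl n, IsGradient φ g Z.1 Z.2 := (existsUnique_gradient hφ g).exists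
  rw [gradients, dif_pos h]
  exact h.choose_spec

theorem IsGradient.nabla_eq {n : ℕ} {φ : M n → ℝ} (hφ : IsSmooth φ) {g : M n} {Z Z' : sl n}
    (h : IsGradient φ g Z Z') : nabla φ g = Z ∧ nabla' φ g = Z' := by
  have he : gradients φ g = (Z, Z') :=
    (existsUnique_gradient hφ g).unique (isGradient_gradients hφ g) h
  rw [nabla, nabla', he]
  exact ⟨rfl, rfl⟩

/-- A vector field of the form `(R ∇H) g + g (R ∇'H)` is the Hamiltonian vector field of `H`. -/
theorem isHamiltonianVectorField_of_eq {n : ℕ} {H : M n → ℝ} {V : M n → Mat n}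
    (hV : ∀ g, V g = R (nabla H g) * (g : Mat n) + (g : Mat n) * R (nabla' H g)) :
    IsHamiltonianVectorField H V := by
  intro g
  have h1 : R (nabla H g) ∈ sl n := R_mem_sl (gradients H g).1.2
  have h2 : R (nabla' H g) ∈ sl n := R_mem_sl (gradients H g).2.2
  set Y := R (nabla H g)
  set Y' := R (nabla' H g)
  -- Tangent vectors are represented as `X g`, so the right translation `g Y'` is rewritten as `(g
  -- Y' g⁻¹) g`.
  have h3 : (g : Mat n) * Y' * ((g⁻¹ : M n) : Mat n) ∈ sl n := by
    rw [mem_sl, Matrix.trace_mul_comm, ← Matrix.mul_assoc, coe_inv_mul_coe, Matrix.one_mul]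
    exact h2
  have h4 : V g = (Y + (g : Mat n) * Y' * ((g⁻¹ : M n) : Mat n)) * (g : Mat n) := by
    rw [hV, Matrix.add_mul, Matrix.mul_assoc _ _ (g : Mat n), coe_inv_mul_coe, Matrix.mul_one]
  refine ⟨⟨_, Submodule.add_mem _ h1 h3⟩, h4, fun φ hφ => ?_⟩
  obtain ⟨D, hD⟩ := hφ.exists_fderiv g
  have h5 := hD _ _ 0 (by simp [expSL_zero])
    (hasDerivAt_expSL_mul g ⟨_, Submodule.add_mem _ h1 h3⟩)
  have h6 := hD _ _ 0 (by simp [expSL_zero]) (hasDerivAt_expSL_mul_expSL g ⟨Y, h1⟩ ⟨Y', h2⟩)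
  have h7 := h6.unique (isGradient_gradients hφ g ⟨Y, h1⟩ ⟨Y', h2⟩)
  -- The gradient of `φ` tested on `X = R ∇H`, `Y = R ∇'H` is exactly the bracket, by symmetry of
  -- the pairing.
  have h8 : bracket φ H g = D ((Y + (g : Mat n) * Y' * ((g⁻¹ : M n) : Mat n)) * (g : Mat n)) := by
    rw [← h4, hV, h7, bracket, pairing_comm, pairing_comm (nabla' φ g)]
    rfl
  rw [h8]
  exact h5

/-- Real and imaginary parts of matrix entries are smooth functions and separate tangent vectors. -/
theorem IsHamiltonianVectorField.unique {n : ℕ} {H : M n → ℝ} {V W : M n → Mat n}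
    (hV : IsHamiltonianVectorField H V) (hW : IsHamiltonianVectorField H W) : W = V := by
  funext g
  obtain ⟨X, hX, hX'⟩ := hV g
  obtain ⟨Y, hY, hY'⟩ := hW g
  have key : ∀ ℓ : Mat n →ₗ[ℝ] ℝ, ℓ (W g) = ℓ (V g) := fun ℓ => by
    have hs : IsSmooth fun g : M n => ℓ (g : Mat n) := (SmoothExt.coe.linear ℓ).isSmooth
    rw [hX, hY, (hasDerivAt_linear ℓ (hasDerivAt_expSL_mul g X)).unique (hX' _ hs),
      (hasDerivAt_linear ℓ (hasDerivAt_expSL_mul g Y)).unique (hY' _ hs)]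
  ext i j
  exact Complex.ext (key (Complex.reLm ∘ₗ Matrix.entryLinearMap ℝ ℂ i j))
    (key (Complex.imLm ∘ₗ Matrix.entryLinearMap ℝ ℂ i j))

/-- The bracket `{φ, H}` is the derivative of `φ` along the Hamiltonian vector field of `H`. -/
theorem IsHamiltonianVectorField.bracket_eq {n : ℕ} {φ H : M n → ℝ} {V : M n → Mat n}
    (hV : IsHamiltonianVectorField H V) (hφ : IsSmooth φ) (g : M n) {d : ℝ}
    (hd : ∀ γ : ℝ → M n, γ 0 = g → HasDerivAt (fun s => (γ s : Mat n)) (V g) 0 →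
      HasDerivAt (fun s => φ (γ s)) d 0) :
    bracket φ H g = d := by
  obtain ⟨X, hX, hX'⟩ := hV g
  exact (hX' φ hφ).unique (hd _ (by simp [expSL_zero]) (hX ▸ hasDerivAt_expSL_mul g X))

/-! ### Traces of powers -/

theorem trace_mul_pow_comm {n : ℕ} (X Y : Mat n) (l : ℕ) :
    ((X * Y) ^ l).trace = ((Y * X) ^ l).trace := by
  cases l with
  | zero => simp
  | succ l =>
    rw [pow_succ, ← Matrix.mul_assoc, mul_pow_mul, Matrix.mul_assoc, Matrix.trace_mul_comm,
      Matrix.mul_assoc, ← pow_succ]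

/-- Cyclicity of the trace makes the `l` summands of the noncommutative power rule equal. -/
theorem hasDerivAt_trace_pow {n : ℕ} {f : ℝ → Mat n} {f' : Mat n} {t : ℝ}
    (hf : HasDerivAt f f' t) (l : ℕ) :
    HasDerivAt (fun s => (f s ^ l).trace) (l * (f t ^ (l - 1) * f').trace) t := by
  have h := hasDerivAt_trace (hf.fun_pow' l)
  refine h.congr_deriv ?_
  rw [Matrix.trace_sum, Finset.sum_congr rfl (g := fun _ => (f t ^ (l - 1) * f').trace)]
  · simp
  · intro i hi
    have hi' : i + (l.pred - i) = l - 1 := by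
      have := Finset.mem_range.1 hi
      rw [Nat.pred_eq_sub_one]; omega
    rw [Matrix.trace_mul_comm, ← Matrix.mul_assoc, ← pow_add, hi']

theorem re_trace_conjTranspose {n : ℕ} (X : Mat n) : (Xᴴ).trace.re = X.trace.re := by
  rw [Matrix.trace_conjTranspose]; rfl

theorem trace_im_eq_zero {n : ℕ} {X : Mat n} (h : X.trace = (Xᴴ).trace) : X.trace.im = 0 := by
  have := congrArg Complex.im h
  rw [Matrix.trace_conjTranspose] at this
  simp at this
  linarith

/-- Taking the adjoint preserves the real part of the trace, but here also reverses its sign. -/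
theorem re_trace_skew_mul_hermitian {n : ℕ} {X Y : Mat n} (hX : Xᴴ = -X) (hY : Yᴴ = Y) :
    (X * Y).trace.re = 0 := by
  have h := re_trace_conjTranspose (X * Y)
  rw [conjTranspose_mul, hX, hY, Matrix.mul_neg, Matrix.trace_neg, Matrix.trace_mul_comm,
    Complex.neg_re] at h
  linarith

/-! ### The functions `F l` -/

theorem conjTranspose_mul_self_eq {n : ℕ} (g : M n) :
    (g : Mat n)ᴴ * (g : Mat n) = (bPart g : Mat n)ᴴ * (bPart g : Mat n) := by
  rw [← coe_kPart_mul_coe_bPart g, conjTranspose_mul, Matrix.mul_assoc,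
    ← Matrix.mul_assoc (kPart g : Mat n)ᴴ, conjTranspose_mul_self_of_mem_K (kPart_mem g),
    Matrix.one_mul]

/-- `b b†` and `b† b = g† g` have the same traces of powers, so `F l` can be treated without the
factorization. -/
theorem trace_Om_pow {n : ℕ} (g : M n) (l : ℕ) :
    (Om g ^ l).trace = (((g : Mat n)ᴴ * (g : Mat n)) ^ l).trace := by
  rw [Om, trace_mul_pow_comm, ← conjTranspose_mul_self_eq g]

theorem F_eq {n : ℕ} (l : ℕ) (g : M n) :
    F l g = 1 / (2 * (l : ℝ)) * ((((g : Mat n)ᴴ * (g : Mat n)) ^ l).trace).re := by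
  rw [F, trace_Om_pow]

theorem isSmooth_F {n : ℕ} (l : ℕ) : IsSmooth (F l : M n → ℝ) := by
  have h : (F l : M n → ℝ) = fun g : M n =>
      1 / (2 * (l : ℝ)) * ((((g : Mat n)ᴴ * (g : Mat n)) ^ l).trace).re := funext (F_eq l)
  rw [h]
  exact ((SmoothExt.const _).mul
    ((SmoothExt.coe.conjTranspose.mul SmoothExt.coe).pow l).trace.re).isSmooth

theorem hermitian_pow_mul_conjTranspose {n : ℕ} (X : Mat n) (l : ℕ) :
    ((X * Xᴴ) ^ l)ᴴ = (X * Xᴴ) ^ l := by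
  rw [conjTranspose_pow, conjTranspose_mul, conjTranspose_conjTranspose]

theorem hermitian_pow_conjTranspose_mul {n : ℕ} (X : Mat n) (l : ℕ) :
    ((Xᴴ * X) ^ l)ᴴ = (Xᴴ * X) ^ l := by
  rw [conjTranspose_pow, conjTranspose_mul, conjTranspose_conjTranspose]

theorem F_ofReal {n : ℕ} (l : ℕ) (g : M n) :
    (F l g : ℂ) = 1 / (2 * (l : ℂ)) * (Om g ^ l).trace := by
  have h : (((Om g ^ l).trace).re : ℂ) = (Om g ^ l).trace :=
    Complex.ext rfl (by
      rw [Complex.ofReal_im, trace_im_eq_zero]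
      rw [Om, hermitian_pow_mul_conjTranspose])
  rw [F, Complex.ofReal_mul, h]
  push_cast
  rfl

theorem hasDerivAt_F {n : ℕ} {l : ℕ} (hl : 1 ≤ l) {γ : ℝ → M n} {v : Mat n} {t : ℝ}
    (hγ : HasDerivAt (fun s => (γ s : Mat n)) v t) :
    HasDerivAt (fun s => F l (γ s))
      ((((γ t : Mat n)ᴴ * (γ t : Mat n)) ^ (l - 1) * ((γ t : Mat n)ᴴ * v)).trace.re) t := by
  have h := (hasDerivAt_re (hasDerivAt_trace_pow
    (hasDerivAt_matrix_mul (hasDerivAt_conjTranspose hγ) hγ) l)).const_mul (1 / (2 * (l : ℝ)))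
  simp only [← F_eq] at h
  refine h.congr_deriv ?_
  have hl' : (l : ℝ) ≠ 0 := by exact_mod_cast (by omega : l ≠ 0)
  -- The terms containing `v†` and `v` have complex conjugate traces; the doubled real part absorbs
  -- the factor `1/2`.
  have h1 := re_trace_conjTranspose
    (((γ t : Mat n)ᴴ * (γ t : Mat n)) ^ (l - 1) * ((γ t : Mat n)ᴴ * v))
  rw [conjTranspose_mul, hermitian_pow_conjTranspose_mul, conjTranspose_mul,
    conjTranspose_conjTranspose, Matrix.trace_mul_comm] at h1
  rw [Matrix.mul_add, Matrix.trace_add, Complex.mul_re, Complex.add_re, h1]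
  simp
  field_simp
  ring

/-- `i` times the traceless part of a matrix. -/
noncomputable def iTraceless {n : ℕ} (X : Mat n) : Mat n :=
  Complex.I • (X - ((2 * (n : ℂ))⁻¹ * X.trace) • (1 : Mat n))

theorem iTraceless_mem_lieK {n : ℕ} (hn : 1 ≤ n) {X : Mat n} (hX : Xᴴ = X) :
    iTraceless X ∈ lieK n := by
  have hn' : (n : ℂ) ≠ 0 := by exact_mod_cast (by omega : n ≠ 0)
  have htr : star X.trace = X.trace := by rw [← Matrix.trace_conjTranspose, hX]
  have htr' : star ((2 * (n : ℂ))⁻¹ * X.trace) = (2 * (n : ℂ))⁻¹ * X.trace := by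
    rw [star_mul', htr]; simp
  refine ⟨?_, ?_⟩
  · rw [iTraceless, conjTranspose_smul, conjTranspose_sub, hX, conjTranspose_smul, htr',
      conjTranspose_one]
    simp
  · rw [iTraceless, Matrix.trace_smul, Matrix.trace_sub, Matrix.trace_smul, Matrix.trace_one,
      Fintype.card_fin]
    have : X.trace - ((2 * (n : ℂ))⁻¹ * X.trace) • ((2 * n : ℕ) : ℂ) = 0 := by
      rw [smul_eq_mul]; push_cast; field_simp; ring
    rw [this, smul_zero]

/-- The factor `i` turns the imaginary part into a real part, and the scalar correction is invisible
to a traceless `X`. That correction, needed for the gradient to lie in `sl n`, is the origin of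
`ν_l`. -/
theorem pairing_iTraceless {n : ℕ} {X Y : Mat n} (hX : X ∈ sl n) :
    pairing X (iTraceless Y) = (X * Y).trace.re := by
  have hX' : X.trace = 0 := hX
  rw [pairing, iTraceless, Matrix.mul_smul, Matrix.trace_smul, Matrix.mul_sub, Matrix.trace_sub,
    Matrix.mul_smul, Matrix.mul_one, Matrix.trace_smul, hX']
  simp

/-- With `P = g†g`, cyclicity turns `Re tr (P^(l-1) g† (X g + g Y))` into `Re tr (X (gg†)^l) + Re tr
(Y P^l)`, from which the gradients are read off. -/
theorem nabla_F {n : ℕ} (hn : 1 ≤ n) {l : ℕ} (hl : 1 ≤ l) (g : M n) :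
    nabla (F l) g = iTraceless (((g : Mat n) * (g : Mat n)ᴴ) ^ l) ∧
      nabla' (F l) g = iTraceless (((g : Mat n)ᴴ * (g : Mat n)) ^ l) := by
  have h1 := iTraceless_mem_lieK hn (hermitian_pow_mul_conjTranspose (g : Mat n) l)
  have h2 := iTraceless_mem_lieK hn (hermitian_pow_conjTranspose_mul (g : Mat n) l)
  refine IsGradient.nabla_eq (isSmooth_F l) (Z := ⟨_, h1.2⟩) (Z' := ⟨_, h2.2⟩) fun X Y => ?_
  have h := hasDerivAt_F hl (hasDerivAt_expSL_mul_expSL g X Y)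
  refine h.congr_deriv (Eq.symm ?_)
  simp only [zero_smul, expSL_zero, one_mul, mul_one]
  rw [pairing_iTraceless X.2, pairing_iTraceless Y.2, ← Complex.add_re, Matrix.mul_add,
    Matrix.mul_add, Matrix.trace_add]
  congr 2
  · rw [← Matrix.mul_assoc, ← Matrix.mul_assoc, Matrix.trace_mul_comm _ (g : Mat n),
      ← Matrix.mul_assoc, ← Matrix.mul_assoc, ← mul_pow_mul, Matrix.mul_assoc _ (g : Mat n),
      ← pow_succ, Nat.sub_add_cancel hl, Matrix.trace_mul_comm]
  · rw [← Matrix.mul_assoc, ← Matrix.mul_assoc, Matrix.mul_assoc _ (g : Mat n)ᴴ, ← pow_succ,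
      Nat.sub_add_cancel hl, Matrix.trace_mul_comm]

/-- The Hamiltonian vector field of `F l`. -/
noncomputable def hamF {n : ℕ} (l : ℕ) (g : M n) : Mat n :=
  (g : Mat n) * iTraceless (((g : Mat n)ᴴ * (g : Mat n)) ^ l)

/-- Both gradients lie in Lie(K), where `R` is `1/2`, and `(gg†)^l g = g (g†g)^l` makes the two
halves equal. -/
theorem isHamiltonianVectorField_hamF {n : ℕ} (hn : 1 ≤ n) {l : ℕ} (hl : 1 ≤ l) :
    IsHamiltonianVectorField (F l) (hamF l : M n → Mat n) := by
  refine isHamiltonianVectorField_of_eq fun g => ?_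
  have h1 := iTraceless_mem_lieK hn (hermitian_pow_mul_conjTranspose (g : Mat n) l)
  have h2 := iTraceless_mem_lieK hn (hermitian_pow_conjTranspose_mul (g : Mat n) l)
  obtain ⟨h3, h4⟩ := nabla_F hn hl g
  have h5 : iTraceless (((g : Mat n) * (g : Mat n)ᴴ) ^ l) * (g : Mat n) =
      (g : Mat n) * iTraceless (((g : Mat n)ᴴ * (g : Mat n)) ^ l) := by
    rw [iTraceless, iTraceless, trace_mul_pow_comm, Matrix.smul_mul, Matrix.mul_smul,
      Matrix.sub_mul, Matrix.mul_sub, mul_pow_mul, Matrix.smul_mul, Matrix.mul_smul,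
      Matrix.one_mul, Matrix.mul_one]
  rw [h3, h4, R_of_mem_lieK h1, R_of_mem_lieK h2, Matrix.smul_mul, h5, Matrix.mul_smul, ← add_smul,
    hamF]
  norm_num

/-- `g†g = b†b` and `b (b†b)^l = (bb†)^l b`, so moving `b` to the right turns `g†g` into `Ω`. -/
theorem hasComponents_hamF {n : ℕ} (hn : 1 ≤ n) (l : ℕ) (g : M n) :
    HasComponents g (hamF l g)
        (Complex.I • ((kPart g : Mat n) *
          (Om g ^ l - ((2 * (n : ℂ))⁻¹ * (Om g ^ l).trace) • (1 : Mat n)))) 0 := by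
  have h := conjTranspose_mul_self_of_mem_K (kPart_mem g)
  refine ⟨?_, ?_, ?_⟩
  · rw [Matrix.mul_smul, ← Matrix.mul_assoc, h, Matrix.one_mul]
    exact iTraceless_mem_lieK hn (by rw [Om, hermitian_pow_mul_conjTranspose])
  · rw [Matrix.zero_mul]
    exact zero_mem_lieB
  · rw [hamF, iTraceless, ← trace_Om_pow, Matrix.mul_zero, add_zero, Matrix.mul_smul,
      Matrix.smul_mul, conjTranspose_mul_self_eq, Om]
    congr 1
    rw [Matrix.mul_assoc (kPart g : Mat n), Matrix.sub_mul, mul_pow_mul]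
    nth_rw 1 [← coe_kPart_mul_coe_bPart g]
    simp only [Matrix.mul_assoc, Matrix.mul_sub, Matrix.mul_smul, Matrix.smul_mul, Matrix.mul_one,
      Matrix.one_mul]

theorem bracket_F_F {n : ℕ} (hn : 1 ≤ n) {l m : ℕ} (hl : 1 ≤ l) (hm : 1 ≤ m) (g : M n) :
    bracket (F m) (F l) g = 0 := by
  refine (isHamiltonianVectorField_hamF hn hl).bracket_eq (isSmooth_F m) g fun γ h0 hγ => ?_
  have h := hasDerivAt_F hm hγ
  subst h0
  refine h.congr_deriv (Eq.symm ?_)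
  set P := (γ 0 : Mat n)ᴴ * (γ 0 : Mat n) with hP
  rw [hamF, ← Matrix.mul_assoc (γ 0 : Mat n)ᴴ, ← hP, ← Matrix.mul_assoc, ← pow_succ,
    Nat.sub_add_cancel hm, Matrix.trace_mul_comm]
  exact (re_trace_skew_mul_hermitian
    (iTraceless_mem_lieK hn (hermitian_pow_conjTranspose_mul (γ 0 : Mat n) l)).1
    (hermitian_pow_conjTranspose_mul (γ 0 : Mat n) m)).symm

/-! ### Identities for `L = k† I k I` -/

theorem Inn_mul_Inn {n : ℕ} : Inn n * Inn n = 1 := by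
  rw [Inn, Matrix.diagonal_mul_diagonal, ← Matrix.diagonal_one]
  congr 1
  funext i
  split_ifs <;> norm_num

theorem Inn_mul_Inn_mul {n : ℕ} (X : Mat n) : Inn n * (Inn n * X) = X := by
  rw [← Matrix.mul_assoc, Inn_mul_Inn, Matrix.one_mul]

theorem conjTranspose_Inn {n : ℕ} : (Inn n)ᴴ = Inn n := by
  rw [Inn, Matrix.diagonal_conjTranspose]
  congr 1
  funext i
  simp only [Pi.star_apply]
  split_ifs <;> simp

/-- `k† I k I` for an arbitrary matrix `k`. -/
noncomputable def Lmat {n : ℕ} (k : Mat n) : Mat n := kᴴ * Inn n * k * Inn n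

theorem L_eq {n : ℕ} (g : M n) : L g = Lmat (kPart g : Mat n) := rfl

/-- `L I = k† I k` is Hermitian. Hence `I L^l` and `L^l I` are Hermitian and the traces of powers of
`L` are real; unitarity of `k` plays no role. -/
theorem conjTranspose_Lmat {n : ℕ} (k : Mat n) : (Lmat k)ᴴ = Inn n * Lmat k * Inn n := by
  simp only [Lmat, conjTranspose_mul, conjTranspose_conjTranspose, conjTranspose_Inn,
    Matrix.mul_assoc, Inn_mul_Inn, Matrix.mul_one]

theorem conjTranspose_Lmat_pow {n : ℕ} (k : Mat n) (l : ℕ) :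
    (Lmat k ^ l)ᴴ = Inn n * Lmat k ^ l * Inn n := by
  rw [conjTranspose_pow, conjTranspose_Lmat]
  induction l with
  | zero => simp [Inn_mul_Inn]
  | succ l ih =>
    rw [pow_succ, ih, pow_succ]
    simp only [Matrix.mul_assoc, Inn_mul_Inn_mul]

theorem hermitian_Inn_mul_Lmat_pow {n : ℕ} (k : Mat n) (l : ℕ) :
    (Inn n * Lmat k ^ l)ᴴ = Inn n * Lmat k ^ l := by
  rw [conjTranspose_mul, conjTranspose_Lmat_pow, conjTranspose_Inn, Matrix.mul_assoc,
    Inn_mul_Inn, Matrix.mul_one]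

theorem hermitian_Lmat_pow_mul_Inn {n : ℕ} (k : Mat n) (l : ℕ) :
    (Lmat k ^ l * Inn n)ᴴ = Lmat k ^ l * Inn n := by
  rw [conjTranspose_mul, conjTranspose_Lmat_pow, conjTranspose_Inn, Matrix.mul_assoc,
    Inn_mul_Inn_mul]

theorem Lmat_mul_Inn {n : ℕ} (k : Mat n) : Lmat k * Inn n = kᴴ * Inn n * k := by
  rw [Lmat, Matrix.mul_assoc, Inn_mul_Inn, Matrix.mul_one]

/-- `L I L = I` for unitary `k`. -/
theorem Lmat_mul_Inn_mul_Lmat {n : ℕ} {k : Mat n} (hk : kᴴ * k = 1) :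
    Lmat k * Inn n * Lmat k = Inn n := by
  have hk' : k * kᴴ = 1 := mul_eq_one_comm.mp hk
  rw [Lmat_mul_Inn, Lmat]
  calc kᴴ * Inn n * k * (kᴴ * Inn n * k * Inn n)
      = kᴴ * Inn n * (k * kᴴ) * Inn n * k * Inn n := by simp only [Matrix.mul_assoc]
    _ = kᴴ * (Inn n * Inn n) * k * Inn n := by rw [hk', Matrix.mul_one, Matrix.mul_assoc kᴴ]
    _ = Inn n := by rw [Inn_mul_Inn, Matrix.mul_one, hk, Matrix.one_mul]

/-- Cyclicity and `L I L = I`. For exponents `l - 1` and `l + 1` this is what makes `rotA`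
traceless. -/
theorem trace_Inn_mul_Lmat_pow_add_two {n : ℕ} {k : Mat n} (hk : kᴴ * k = 1) (j : ℕ) :
    (Inn n * Lmat k ^ (j + 2)).trace = (Inn n * Lmat k ^ j).trace := by
  rw [pow_succ, pow_succ', ← Matrix.mul_assoc, ← Matrix.mul_assoc, Matrix.trace_mul_comm,
    ← Matrix.mul_assoc, ← Matrix.mul_assoc, Lmat_mul_Inn_mul_Lmat hk]

/-- The infinitesimal right rotation of `k` along the Hamiltonian flow of `Phi l`. -/
noncomputable def rotA {n : ℕ} (l : ℕ) (k : Mat n) : Mat n :=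
  (Complex.I / 2) • (Inn n * Lmat k ^ (l - 1) - Lmat k ^ (l + 1) * Inn n - Inn n * Lmat k ^ l +
    Lmat k ^ l * Inn n)

/-- The infinitesimal left translation of `b` along the Hamiltonian flow of `Phi l`. -/
noncomputable def transN {n : ℕ} (l : ℕ) (k : Mat n) : Mat n :=
  (Complex.I / 2) • ((1 + Inn n) * Lmat k ^ l * (1 - Inn n))

/-- The infinitesimal left translation of `g` along the Hamiltonian flow of `Phi l`. -/
noncomputable def transQ {n : ℕ} (l : ℕ) (k : Mat n) : Mat n :=
  (Complex.I / 2) • ((1 + Inn n) * (k * Lmat k ^ l * kᴴ) * (1 - Inn n))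

theorem rotA_skew {n : ℕ} (l : ℕ) (k : Mat n) : (rotA l k)ᴴ = -rotA l k := by
  rw [rotA, conjTranspose_smul, conjTranspose_add, conjTranspose_sub, conjTranspose_sub,
    hermitian_Inn_mul_Lmat_pow, hermitian_Inn_mul_Lmat_pow, hermitian_Lmat_pow_mul_Inn,
    hermitian_Lmat_pow_mul_Inn, ← neg_smul]
  congr 1
  simp [neg_div]

theorem rotA_mem_lieK {n : ℕ} {l : ℕ} (hl : 1 ≤ l) {k : Mat n} (hk : kᴴ * k = 1) :
    rotA l k ∈ lieK n := by
  refine ⟨rotA_skew l k, ?_⟩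
  have h := trace_Inn_mul_Lmat_pow_add_two hk (l - 1)
  rw [show l - 1 + 2 = l + 1 by omega] at h
  rw [rotA, Matrix.trace_smul, Matrix.trace_add, Matrix.trace_sub, Matrix.trace_sub,
    Matrix.trace_mul_comm _ (Inn n), h, Matrix.trace_mul_comm _ (Inn n), sub_self, zero_sub,
    neg_add_cancel, smul_zero]

theorem block_apply {n : ℕ} (X : Mat n) (i j : Fin (2 * n)) :
    ((1 + Inn n) * X * (1 - Inn n)) i j = if i.val < n ∧ n ≤ j.val then 4 * X i j else 0 := by
  have h1 : (1 + Inn n) = Matrix.diagonal fun i : Fin (2 * n) => if i.val < n then (2 : ℂ) else 0 := by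
    rw [Inn, ← Matrix.diagonal_one, Matrix.diagonal_add]
    congr 1
    funext i
    split_ifs <;> norm_num
  have h2 : (1 - Inn n) = Matrix.diagonal fun i : Fin (2 * n) => if i.val < n then (0 : ℂ) else 2 := by
    rw [Inn, ← Matrix.diagonal_one, Matrix.diagonal_sub]
    congr 1
    funext i
    split_ifs <;> norm_num
  rw [h1, h2, Matrix.mul_diagonal, Matrix.diagonal_mul]
  rcases lt_or_ge i.val n with hi | hi <;> rcases lt_or_ge j.val n with hj | hj
  · simp [hi, hj]
  · simp only [hi, hj, hj.not_gt, if_true, if_false, and_self]; ring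
  · simp [hi.not_gt]
  · simp [hi.not_gt]

/-- The upper right `n × n` block lies strictly above the diagonal, so the reality and trace
conditions are empty and any complex factor is allowed. -/
theorem smul_block_mem_lieB {n : ℕ} (c : ℂ) (X : Mat n) :
    c • ((1 + Inn n) * X * (1 - Inn n)) ∈ lieB n := by
  have h : ∀ i j : Fin (2 * n), j ≤ i → (c • ((1 + Inn n) * X * (1 - Inn n))) i j = 0 := by
    intro i j hij
    rw [Matrix.smul_apply, block_apply, if_neg, smul_zero]
    have : j.val ≤ i.val := hij
    omega
  refine ⟨fun i j hij => h i j hij.le, fun i => by rw [h i i le_rfl, Complex.zero_im], ?_⟩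
  exact Finset.sum_eq_zero fun i _ => h i i le_rfl

theorem transN_mem_lieB {n : ℕ} (l : ℕ) (k : Mat n) : transN l k ∈ lieB n :=
  smul_block_mem_lieB _ _

/-- With `S = L I = k† I k`, the relations `S L = I` and `I² = 1` give `A + N = (i/2)(1 + S) L^l (1
- S)`. Unitarity yields `k S = I k` and `S k† = k† I`, so conjugation by `k` replaces `S` by `I`.
The identity exhibits `-k N k† = k A k† - Q` as the splitting of the left gradient of `Phi l` along
Lie(K) + Lie(B). -/
theorem rotA_add_transN {n : ℕ} {l : ℕ} (hl : 1 ≤ l) {k : Mat n} (hk : kᴴ * k = 1) :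
    k * (rotA l k + transN l k) * kᴴ = transQ l k := by
  have hk' : k * kᴴ = 1 := mul_eq_one_comm.mp hk
  set S := Lmat k * Inn n with hS
  have hSdef : S = kᴴ * Inn n * k := Lmat_mul_Inn k
  have hSL : S * Lmat k = Inn n := Lmat_mul_Inn_mul_Lmat hk
  have h1 : S * Lmat k ^ l = Inn n * Lmat k ^ (l - 1) := by
    conv_lhs => rw [← Nat.sub_add_cancel hl, pow_succ', ← Matrix.mul_assoc, hSL]
  have h2 : Lmat k ^ l * S = Lmat k ^ (l + 1) * Inn n := by
    rw [hS, ← Matrix.mul_assoc, ← pow_succ]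
  have h3 : S * Lmat k ^ l * S = Inn n * Lmat k ^ l * Inn n := by
    rw [h1, hS, ← Matrix.mul_assoc, Matrix.mul_assoc (Inn n), ← pow_succ, Nat.sub_add_cancel hl]
  have h4 : rotA l k + transN l k = (Complex.I / 2) • ((1 + S) * Lmat k ^ l * (1 - S)) := by
    rw [rotA, transN, ← smul_add]
    congr 1
    have e1 : (1 + S) * Lmat k ^ l * (1 - S) =
        Lmat k ^ l + S * Lmat k ^ l - Lmat k ^ l * S - S * Lmat k ^ l * S := by noncomm_ring
    rw [e1, h3, h1, h2]
    noncomm_ring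
  have h5 : k * (1 + S) = (1 + Inn n) * k := by
    rw [Matrix.mul_add, Matrix.add_mul, hSdef, Matrix.mul_one, Matrix.one_mul, ← Matrix.mul_assoc,
      ← Matrix.mul_assoc, hk', Matrix.one_mul]
  have h6 : (1 - S) * kᴴ = kᴴ * (1 - Inn n) := by
    rw [Matrix.mul_sub, Matrix.sub_mul, hSdef, Matrix.mul_one, Matrix.one_mul,
      Matrix.mul_assoc _ k, hk', Matrix.mul_one]
  rw [h4, transQ, Matrix.mul_smul, Matrix.smul_mul]
  congr 1
  calc k * ((1 + S) * Lmat k ^ l * (1 - S)) * kᴴ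
      = (k * (1 + S)) * Lmat k ^ l * ((1 - S) * kᴴ) := by simp only [Matrix.mul_assoc]
    _ = _ := by rw [h5, h6]; simp only [Matrix.mul_assoc]

/-! ### The functions `Phi l` -/

theorem isSmooth_Phi {n : ℕ} (l : ℕ) : IsSmooth (Phi l : M n → ℝ) := by
  have hL : SmoothExt (fun g : M n => L g) :=
    ((smoothExt_kPart.conjTranspose.mul (SmoothExt.const (Inn n))).mul smoothExt_kPart).mul
      (SmoothExt.const (Inn n))
  exact ((SmoothExt.const (1 / (2 * (l : ℝ)))).mul (hL.pow l).trace.re).isSmooth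

theorem Phi_ofReal {n : ℕ} (l : ℕ) (g : M n) :
    (Phi l g : ℂ) = 1 / (2 * (l : ℂ)) * (L g ^ l).trace := by
  have h : (((L g ^ l).trace).re : ℂ) = (L g ^ l).trace :=
    Complex.ext rfl (by
      rw [Complex.ofReal_im, trace_im_eq_zero]
      rw [L_eq, conjTranspose_Lmat_pow, Matrix.trace_mul_comm, Inn_mul_Inn_mul])
  rw [Phi, Complex.ofReal_mul, h]
  push_cast
  rfl

/-- For `k̇ = k A` with `A` skew-Hermitian, `S = k† I k` moves by the commutator `S A - A S`; the
rest is `L = S I` and cyclicity. -/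
theorem hasDerivAt_Phi {n : ℕ} {l : ℕ} (hl : 1 ≤ l) {γ : ℝ → M n} {A : Mat n}
    {t : ℝ} (hA : Aᴴ = -A)
    (hγ : HasDerivAt (fun s => (kPart (γ s) : Mat n)) ((kPart (γ t) : Mat n) * A) t) :
    HasDerivAt (fun s => Phi l (γ s))
      (1 / 2 * (A * (Inn n * L (γ t) ^ l * Inn n - L (γ t) ^ l)).trace.re) t := by
  set k := (kPart (γ t) : Mat n) with hk
  have h1 : HasDerivAt (fun s => L (γ s))
      (((k * A)ᴴ * Inn n * k + kᴴ * Inn n * (k * A)) * Inn n) t := by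
    have h := hasDerivAt_matrix_mul (hasDerivAt_matrix_mul (hasDerivAt_matrix_mul
      (hasDerivAt_conjTranspose hγ) (hasDerivAt_const t (Inn n))) hγ) (hasDerivAt_const t (Inn n))
    refine h.congr_deriv ?_
    simp only [Matrix.mul_zero, add_zero, ← hk]
  have h := (hasDerivAt_re (hasDerivAt_trace_pow h1 l)).const_mul (1 / (2 * (l : ℝ)))
  refine h.congr_deriv ?_
  have hl' : (l : ℝ) ≠ 0 := by exact_mod_cast (by omega : l ≠ 0)
  set S := kᴴ * Inn n * k with hS
  have hL : L (γ t) = S * Inn n := rfl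
  have h2 : ((k * A)ᴴ * Inn n * k + kᴴ * Inn n * (k * A)) * Inn n = (S * A - A * S) * Inn n := by
    rw [conjTranspose_mul, hA, hS]
    noncomm_ring
  have h3 : (L (γ t) ^ (l - 1) * ((S * A - A * S) * Inn n)).trace =
      (A * (Inn n * L (γ t) ^ l * Inn n - L (γ t) ^ l)).trace := by
    have e1 : (L (γ t) ^ (l - 1) * (S * A * Inn n)).trace =
        (A * (Inn n * L (γ t) ^ l * Inn n)).trace := by
      have hS' : L (γ t) * Inn n = S := by rw [hL, Matrix.mul_assoc, Inn_mul_Inn, Matrix.mul_one]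
      conv_rhs => rw [← Nat.sub_add_cancel hl, pow_succ]
      rw [← Matrix.mul_assoc, ← Matrix.mul_assoc, Matrix.mul_assoc _ A, Matrix.trace_mul_comm]
      simp only [Matrix.mul_assoc, hS']
    have e2 : (L (γ t) ^ (l - 1) * (A * S * Inn n)).trace = (A * L (γ t) ^ l).trace := by
      rw [Matrix.mul_assoc A, ← hL, Matrix.trace_mul_comm, Matrix.mul_assoc, ← pow_succ',
        Nat.sub_add_cancel hl]
    rw [Matrix.sub_mul, Matrix.mul_sub, Matrix.trace_sub, e1, e2, Matrix.mul_sub, Matrix.trace_sub]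
  rw [h2, Complex.mul_re, h3]
  simp
  field_simp

/-- In the expansion of `(1 + I) L^l (1 - I)` the terms `I L^l` and `L^l I` are Hermitian and drop
out against `A`. What remains is the derivative of `Phi l` along `k A`, so `-N` represents that
derivative on Lie(K). -/
theorem trace_skew_mul_transN_im {n : ℕ} (l : ℕ) (k : Mat n) {A : Mat n} (hA : Aᴴ = -A) :
    (A * transN l k).trace.im =
      -(1 / 2 * (A * (Inn n * Lmat k ^ l * Inn n - Lmat k ^ l)).trace.re) := by
  have h1 := re_trace_skew_mul_hermitian hA (hermitian_Inn_mul_Lmat_pow k l)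
  have h2 := re_trace_skew_mul_hermitian hA (hermitian_Lmat_pow_mul_Inn k l)
  have h3 : (1 + Inn n) * Lmat k ^ l * (1 - Inn n) = (Inn n * Lmat k ^ l - Lmat k ^ l * Inn n) -
      (Inn n * Lmat k ^ l * Inn n - Lmat k ^ l) := by noncomm_ring
  rw [transN, Matrix.mul_smul, Matrix.trace_smul, h3, Matrix.mul_sub, Matrix.mul_sub A,
    Matrix.trace_sub, Matrix.trace_sub]
  simp [Complex.mul_im, h1, h2]

theorem conj_transN_mem_lieB {n : ℕ} (l : ℕ) (g : M n) :
    -(((bPart g)⁻¹ : M n) * transN l (kPart g : Mat n) * (bPart g : Mat n)) ∈ lieB n := by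
  have h1 := mem_lieB_iff.1 (transN_mem_lieB l (kPart g : Mat n))
  have hb := isUpperReal_of_mem_B (bPart_mem g)
  have hb' := isUpperReal_of_mem_B ((B n).inv_mem (bPart_mem g))
  have h2 := (hb'.mul h1.1).mul hb
  refine mem_lieB_iff.2 ⟨⟨fun i j hij => ?_, fun i => ?_⟩, ?_⟩
  · rw [Matrix.neg_apply, h2.1 i j hij, neg_zero]
  · rw [Matrix.neg_apply, Complex.neg_im, h2.2 i, neg_zero]
  · rw [Matrix.trace_neg, Matrix.trace_mul_comm, ← Matrix.mul_assoc, coe_mul_coe_inv,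
      Matrix.one_mul, h1.2, neg_zero]

/-- `X g + g Y = k W b`, and splitting `W` along Lie(K) + Lie(B) separates the motion of `k` from
that of `b`. -/
theorem hasComponents_mul_add_mul {n : ℕ} (g : M n) {X Y W : Mat n} (hWsl : W ∈ sl n)
    (hW : W = (kPart g : Mat n)ᴴ * X * (kPart g : Mat n) +
      (bPart g : Mat n) * Y * ((bPart g)⁻¹ : M n)) :
    HasComponents g (X * (g : Mat n) + (g : Mat n) * Y) ((kPart g : Mat n) * projK W)
      (projB W * (bPart g : Mat n)) := by
  obtain ⟨hWK, hWB, hWe⟩ := proj_mem hWsl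
  have hk := conjTranspose_mul_self_of_mem_K (kPart_mem g)
  have hk' := mul_conjTranspose_self_of_mem_K (kPart_mem g)
  have hbc := coe_mul_coe_inv (bPart g)
  have hcb := coe_inv_mul_coe (bPart g)
  have hkb := coe_kPart_mul_coe_bPart g
  refine ⟨?_, ?_, ?_⟩
  · rw [← Matrix.mul_assoc, hk, Matrix.one_mul]; exact hWK
  · rw [Matrix.mul_assoc, hbc, Matrix.mul_one]; exact hWB
  · rw [← Matrix.mul_assoc, ← Matrix.add_mul, ← Matrix.mul_add, ← hWe, hW,
      Matrix.mul_add, ← Matrix.mul_assoc, ← Matrix.mul_assoc, hk', Matrix.one_mul,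
      Matrix.add_mul, Matrix.mul_assoc X, hkb]
    congr 1
    rw [← Matrix.mul_assoc, ← Matrix.mul_assoc, hkb, Matrix.mul_assoc _ _ (bPart g : Mat n), hcb,
      Matrix.mul_one]

theorem pairing_conj_add_pairing_conj {n : ℕ} (k k' b c N X Y : Mat n) :
    pairing X (-(k * N * k')) + pairing Y (-(c * N * b)) =
      -((k' * X * k + b * Y * c) * N).trace.im := by
  rw [Matrix.add_mul, Matrix.trace_add, pairing, pairing, Matrix.mul_neg, Matrix.mul_neg,
    Matrix.trace_neg, Matrix.trace_neg, Complex.neg_im, Complex.neg_im, Complex.add_im, neg_add]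
  congr 3
  · rw [← Matrix.mul_assoc, Matrix.trace_mul_comm]
    simp only [Matrix.mul_assoc]
  · rw [← Matrix.mul_assoc, Matrix.trace_mul_comm]
    simp only [Matrix.mul_assoc]

/-- Along `X g + g Y` the factor `k` rotates by `projK W`, so the derivative of `Phi l` is `-Im tr
(projK W · N)`. As `N` lies in the isotropic subalgebra Lie(B), `projK W` may be replaced by `W`,
and cyclicity distributes `N` over `X` and `Y`. -/
theorem nabla_Phi {n : ℕ} {l : ℕ} (hl : 1 ≤ l) (g : M n) :
    nabla (Phi l) g = -((kPart g : Mat n) * transN l (kPart g : Mat n) * (kPart g : Mat n)ᴴ) ∧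
      nabla' (Phi l) g =
        -(((bPart g)⁻¹ : M n) * transN l (kPart g : Mat n) * (bPart g : Mat n)) := by
  have hN := transN_mem_lieB l (kPart g : Mat n)
  have h1 : -((kPart g : Mat n) * transN l (kPart g : Mat n) * (kPart g : Mat n)ᴴ) ∈ sl n := by
    rw [mem_sl, Matrix.trace_neg, Matrix.trace_mul_comm, ← Matrix.mul_assoc,
      conjTranspose_mul_self_of_mem_K (kPart_mem g), Matrix.one_mul, hN.2.2, neg_zero]
  refine IsGradient.nabla_eq (isSmooth_Phi l) (Z := ⟨_, h1⟩)
    (Z' := ⟨_, (conj_transN_mem_lieB l g).2.2⟩) fun X Y => ?_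
  have hX : (X : Mat n).trace = 0 := X.2
  have hY : (Y : Mat n).trace = 0 := Y.2
  obtain ⟨W, hW⟩ : ∃ W, W = (kPart g : Mat n)ᴴ * (X : Mat n) * (kPart g : Mat n) +
    (bPart g : Mat n) * (Y : Mat n) * ((bPart g)⁻¹ : M n) := ⟨_, rfl⟩
  have hWsl : W ∈ sl n := by
    rw [mem_sl, hW, Matrix.trace_add, Matrix.trace_mul_comm, ← Matrix.mul_assoc,
      mul_conjTranspose_self_of_mem_K (kPart_mem g), Matrix.one_mul, hX, Matrix.trace_mul_comm,
      ← Matrix.mul_assoc, coe_inv_mul_coe, Matrix.one_mul, hY, add_zero]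
  obtain ⟨hWK, hWB, hWe⟩ := proj_mem hWsl
  have hcomp := hasComponents_mul_add_mul g hWsl hW
  have hcurve := hasDerivAt_expSL_mul_expSL g X Y
  obtain ⟨γ, hγ⟩ : ∃ γ : ℝ → M n, γ = fun t => expSL (t • X) * g * expSL (t • Y) := ⟨_, rfl⟩
  have h0 : γ 0 = g := by simp [hγ, expSL_zero]
  have hcurve' : HasDerivAt (fun t => (γ t : Mat n))
      ((X : Mat n) * (g : Mat n) + (g : Mat n) * (Y : Mat n)) 0 := by
    rw [hγ]; exact hcurve
  have hcomp' : HasComponents (γ 0) ((X : Mat n) * (g : Mat n) + (g : Mat n) * (Y : Mat n))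
      ((kPart g : Mat n) * projK W) (projB W * (bPart g : Mat n)) := by
    rw [h0]; exact hcomp
  have hder := (hcomp'.hasDerivAt hcurve').1
  have h := hasDerivAt_Phi hl (γ := γ) (t := 0) hWK.1 (by rw [h0]; exact hder)
  rw [h0] at h
  have h2 : (projB W * transN l (kPart g : Mat n)).trace.im = 0 :=
    ((mem_lieB_iff.1 hWB).1.mul (mem_lieB_iff.1 hN).1).trace_im
  have h4 : (W * transN l (kPart g : Mat n)).trace.im =
      (projK W * transN l (kPart g : Mat n)).trace.im := by
    conv_lhs => rw [hWe]
    rw [Matrix.add_mul, Matrix.trace_add, Complex.add_im, h2, add_zero]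
  have h5 := hγ ▸ h
  refine h5.congr_deriv ?_
  rw [pairing_conj_add_pairing_conj, ← hW, h4, trace_skew_mul_transN_im l _ hWK.1, neg_neg, L_eq]

/-- The Hamiltonian vector field of `Phi l`. -/
noncomputable def hamPhi {n : ℕ} (l : ℕ) (g : M n) : Mat n :=
  (kPart g : Mat n) * rotA l (kPart g : Mat n) * (bPart g : Mat n) +
    (kPart g : Mat n) * (transN l (kPart g : Mat n) * (bPart g : Mat n))

/-- The right gradient lies in Lie(B) and contributes `½ k N b`. The left gradient `k A k† - Q` is
mapped by `R` to `½ (k A k† + Q)`, which contributes `k A b + ½ k N b`. -/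
theorem isHamiltonianVectorField_hamPhi {n : ℕ} {l : ℕ} (hl : 1 ≤ l) :
    IsHamiltonianVectorField (Phi l) (hamPhi l : M n → Mat n) := by
  refine isHamiltonianVectorField_of_eq fun g => ?_
  obtain ⟨h1, h2⟩ := nabla_Phi hl g
  have hV : hamPhi l g = (kPart g : Mat n) * rotA l (kPart g : Mat n) * (bPart g : Mat n) +
    (kPart g : Mat n) * (transN l (kPart g : Mat n) * (bPart g : Mat n)) := rfl
  have h3 := R_of_mem_lieB (conj_transN_mem_lieB l g)
  rw [← h2] at h3
  set k := (kPart g : Mat n) with hkdef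
  set b := (bPart g : Mat n) with hbdef
  set c := (((bPart g)⁻¹ : M n) : Mat n) with hcdef
  have hk : kᴴ * k = 1 := conjTranspose_mul_self_of_mem_K (kPart_mem g)
  have hbc : b * c = 1 := coe_mul_coe_inv _
  have hkb : k * b = (g : Mat n) := coe_kPart_mul_coe_bPart g
  have hA := rotA_mem_lieK hl hk
  have h4 : k * rotA l k * kᴴ ∈ lieK n := by
    refine ⟨?_, ?_⟩
    · rw [conjTranspose_mul, conjTranspose_mul, conjTranspose_conjTranspose, hA.1]
      noncomm_ring
    · rw [Matrix.trace_mul_comm, ← Matrix.mul_assoc, hk, Matrix.one_mul, hA.2]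
  have h5 : -transQ l k ∈ lieB n := by
    rw [transQ, ← neg_smul]
    exact smul_block_mem_lieB _ _
  have h6 : nabla (Phi l) g = k * rotA l k * kᴴ + -transQ l k := by
    rw [h1, ← rotA_add_transN hl hk]
    noncomm_ring
  have h7 : R (nabla (Phi l) g) * (g : Mat n) =
      (k * rotA l k * b) + (1 / 2 : ℝ) • (k * transN l k * b) := by
    have e : ∀ X : Mat n, k * X * kᴴ * (g : Mat n) = k * X * b := fun X => by
      rw [← hkb, Matrix.mul_assoc, ← Matrix.mul_assoc kᴴ, hk, Matrix.one_mul]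
    rw [h6, R_add h4 h5, sub_neg_eq_add, ← rotA_add_transN hl hk, Matrix.smul_mul, Matrix.add_mul,
      e, e, Matrix.mul_add, Matrix.add_mul, ← add_assoc, ← two_smul ℝ, smul_add, smul_smul]
    norm_num
  have h8 : (g : Mat n) * R (nabla' (Phi l) g) = (1 / 2 : ℝ) • (k * transN l k * b) := by
    rw [h3, h2, smul_neg, neg_neg, Matrix.mul_smul, ← hkb, Matrix.mul_assoc c,
      ← Matrix.mul_assoc (k * b), Matrix.mul_assoc k b c, hbc, Matrix.mul_one, Matrix.mul_assoc k]
  rw [h7, h8, add_assoc, ← add_smul, hV]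
  norm_num [Matrix.mul_assoc]

theorem hasComponents_hamPhi_rotA {n : ℕ} {l : ℕ} (hl : 1 ≤ l) (g : M n) :
    HasComponents g (hamPhi l g) ((kPart g : Mat n) * rotA l (kPart g : Mat n))
      (transN l (kPart g : Mat n) * (bPart g : Mat n)) := by
  have hk := conjTranspose_mul_self_of_mem_K (kPart_mem g)
  refine ⟨?_, ?_, rfl⟩
  · rw [← Matrix.mul_assoc, hk, Matrix.one_mul]
    exact rotA_mem_lieK hl hk
  · rw [Matrix.mul_assoc, coe_mul_coe_inv, Matrix.mul_one]
    exact transN_mem_lieB l _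

theorem hasComponents_hamPhi {n : ℕ} {l : ℕ} (hl : 1 ≤ l) (g : M n) :
    HasComponents g (hamPhi l g)
        ((Complex.I / 2) • ((kPart g : Mat n) *
          (Inn n * L g ^ (l - 1) - L g ^ (l + 1) * Inn n - Inn n * L g ^ l + L g ^ l * Inn n)))
        ((Complex.I / 2) • ((1 + Inn n) * L g ^ l * (1 - Inn n) * (bPart g : Mat n))) := by
  have h := hasComponents_hamPhi_rotA hl g
  rw [rotA, transN, Matrix.mul_smul, Matrix.smul_mul] at h
  exact h

/-- By commutation and cyclicity `tr (X I Y) = tr (I X Y)`, and the two terms of each trace cancel.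
With powers of `L` for `X` and `Y`, this kills every summand of `rotA` in the bracket of two `Phi`s.
-/
theorem trace_Inn_mul_mul_sub {n : ℕ} {X Y : Mat n} (h : X * Y = Y * X) :
    (Inn n * X * (Inn n * Y * Inn n - Y)).trace = 0 ∧
      (X * Inn n * (Inn n * Y * Inn n - Y)).trace = 0 := by
  have h1 : (X * Inn n * Y).trace = (Inn n * X * Y).trace := by
    rw [Matrix.mul_assoc, Matrix.trace_mul_comm, Matrix.mul_assoc, ← h, Matrix.mul_assoc]
  constructor
  · rw [Matrix.mul_sub, Matrix.trace_sub, ← h1, ← Matrix.mul_assoc, Matrix.trace_mul_comm]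
    simp only [Matrix.mul_assoc, Inn_mul_Inn_mul, sub_self]
  · rw [Matrix.mul_sub, Matrix.trace_sub, h1, ← Matrix.mul_assoc, Matrix.trace_mul_comm]
    simp only [Matrix.mul_assoc, Inn_mul_Inn_mul, sub_self]

theorem bracket_Phi_Phi {n : ℕ} {l m : ℕ} (hl : 1 ≤ l) (hm : 1 ≤ m) (g : M n) :
    bracket (Phi m) (Phi l) g = 0 := by
  refine (isHamiltonianVectorField_hamPhi hl).bracket_eq (isSmooth_Phi m) g fun γ h0 hγ => ?_
  subst h0
  have hk := conjTranspose_mul_self_of_mem_K (kPart_mem (γ 0))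
  have h := hasDerivAt_Phi hm (rotA_skew l _)
    ((hasComponents_hamPhi_rotA hl (γ 0)).hasDerivAt hγ).1
  refine h.congr_deriv ?_
  rw [L_eq]
  set k := (kPart (γ 0) : Mat n)
  have h1 := fun p => trace_Inn_mul_mul_sub (pow_mul_comm (Lmat k) p m)
  rw [rotA, Matrix.smul_mul, Matrix.trace_smul, Matrix.add_mul, Matrix.sub_mul, Matrix.sub_mul,
    Matrix.trace_add, Matrix.trace_sub, Matrix.trace_sub, (h1 _).1, (h1 _).1, (h1 _).2, (h1 _).2]
  simp

/-! ### Invariance under `K₊ × K₊` -/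

theorem F_invariant {n : ℕ} (l : ℕ) {f₁ f₂ : M n} (h₁ : f₁ ∈ K n) (h₂ : f₂ ∈ K n) (g : M n) :
    F l (f₁ * g * f₂⁻¹) = F l g := by
  have h : ((f₁ * g * f₂⁻¹ : M n) : Mat n)ᴴ * ((f₁ * g * f₂⁻¹ : M n) : Mat n) =
      (f₂ : Mat n) * (((g : Mat n)ᴴ * (g : Mat n)) * (f₂ : Mat n)ᴴ) := by
    rw [Matrix.SpecialLinearGroup.coe_mul, Matrix.SpecialLinearGroup.coe_mul, coe_inv_of_mem_K h₂,
      conjTranspose_mul, conjTranspose_mul, conjTranspose_conjTranspose]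
    simp only [Matrix.mul_assoc]
    rw [← Matrix.mul_assoc (f₁ : Mat n)ᴴ, conjTranspose_mul_self_of_mem_K h₁, Matrix.one_mul]
  rw [F_eq, F_eq, h, trace_mul_pow_comm, Matrix.mul_assoc, conjTranspose_mul_self_of_mem_K h₂,
    Matrix.mul_one]

/-- Block upper triangular matrices. -/
def IsBlockUpper {n : ℕ} (X : Mat n) : Prop := (1 - Inn n) * X * (1 + Inn n) = 0

theorem IsBlockUpper.mul {n : ℕ} {X Y : Mat n} (hX : IsBlockUpper X) (hY : IsBlockUpper Y) :
    IsBlockUpper (X * Y) := by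
  -- The factor `2 = (1 + I) + (1 - I)` is inserted between `X` and `Y`.
  have h : (2 : ℂ) • ((1 - Inn n) * (X * Y) * (1 + Inn n)) =
      ((1 - Inn n) * X * (1 + Inn n)) * (Y * (1 + Inn n)) +
        ((1 - Inn n) * X) * ((1 - Inn n) * Y * (1 + Inn n)) := by
    rw [two_smul]; noncomm_ring
  rw [hX, hY, Matrix.zero_mul, Matrix.mul_zero, add_zero] at h
  exact (smul_eq_zero.1 h).resolve_left two_ne_zero

theorem isBlockUpper_of_mem_B {n : ℕ} {b : M n} (hb : b ∈ B n) : IsBlockUpper (b : Mat n) := by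
  have h1 : (1 - Inn n) = Matrix.diagonal fun i : Fin (2 * n) => if i.val < n then (0 : ℂ) else 2 := by
    rw [Inn, ← Matrix.diagonal_one, Matrix.diagonal_sub]
    congr 1
    funext i
    split_ifs <;> norm_num
  have h2 : (1 + Inn n) = Matrix.diagonal fun i : Fin (2 * n) => if i.val < n then (2 : ℂ) else 0 := by
    rw [Inn, ← Matrix.diagonal_one, Matrix.diagonal_add]
    congr 1
    funext i
    split_ifs <;> norm_num
  ext i j
  rw [h1, h2, Matrix.mul_diagonal, Matrix.diagonal_mul, Matrix.zero_apply]
  by_cases hi : i.val < n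
  · simp [hi]
  · by_cases hj : j.val < n
    · have : j < i := by rw [Fin.lt_def]; omega
      rw [hb.1 i j this]; simp
    · simp [hj]

theorem commute_Inn_of_mem_Kplus {n : ℕ} {f : M n} (hf : f ∈ Kplus n) :
    (f : Mat n) * Inn n = Inn n * (f : Mat n) := by
  have h := congrArg (fun X => (f : Mat n) * X) hf.2
  simp only [← Matrix.mul_assoc] at h
  rw [mul_conjTranspose_self_of_mem_K hf.1, Matrix.one_mul] at h
  exact h.symm

theorem isBlockUpper_of_commute {n : ℕ} {X : Mat n} (hX : X * Inn n = Inn n * X) :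
    IsBlockUpper X := by
  have h : (1 - Inn n) * X * (1 + Inn n) = X * (1 - Inn n * Inn n) + (X * Inn n - Inn n * X) +
      (X * Inn n - Inn n * X) * Inn n := by noncomm_ring
  rw [IsBlockUpper, h, Inn_mul_Inn, hX]
  simp

/-- With `b` the `B` factor of `x`, the unitary factor is `x b⁻¹` and its inverse is `b x⁻¹`, both
block upper triangular. The inverse being the adjoint, the factor is block diagonal, that is,
commutes with `I`. -/
theorem kPart_mem_Kplus {n : ℕ} {x : M n} (hx : IsBlockUpper (x : Mat n))
    (hx' : IsBlockUpper ((x⁻¹ : M n) : Mat n)) : kPart x ∈ Kplus n := by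
  have hu := kPart_mem x
  have h1 : IsBlockUpper (kPart x : Mat n) := by
    have e : kPart x = x * (bPart x)⁻¹ := by rw [eq_mul_inv_iff_mul_eq, kPart_mul_bPart]
    rw [e, Matrix.SpecialLinearGroup.coe_mul]
    exact hx.mul (isBlockUpper_of_mem_B ((B n).inv_mem (bPart_mem x)))
  have h2 : IsBlockUpper (kPart x : Mat n)ᴴ := by
    have e : (kPart x)⁻¹ = bPart x * x⁻¹ := by
      rw [eq_mul_inv_iff_mul_eq, inv_mul_eq_iff_eq_mul, kPart_mul_bPart]
    rw [← coe_inv_of_mem_K hu, e, Matrix.SpecialLinearGroup.coe_mul]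
    exact (isBlockUpper_of_mem_B (bPart_mem x)).mul hx'
  have h3 : (1 + Inn n) * (kPart x : Mat n) * (1 - Inn n) = 0 := by
    have h := congrArg conjTranspose h2
    rw [conjTranspose_mul, conjTranspose_mul, conjTranspose_conjTranspose, conjTranspose_add,
      conjTranspose_sub, conjTranspose_Inn, conjTranspose_one, conjTranspose_zero,
      ← Matrix.mul_assoc] at h
    exact h
  -- The difference of the two off-diagonal blocks is twice the commutator with `I`.
  have h4 : (2 : ℂ) • ((kPart x : Mat n) * Inn n - Inn n * (kPart x : Mat n)) =
      (1 - Inn n) * (kPart x : Mat n) * (1 + Inn n) -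
        (1 + Inn n) * (kPart x : Mat n) * (1 - Inn n) := by
    rw [two_smul]; noncomm_ring
  rw [h1, h3, sub_zero] at h4
  have h5 := sub_eq_zero.1 ((smul_eq_zero.1 h4).resolve_left two_ne_zero)
  refine ⟨hu, ?_⟩
  rw [Matrix.mul_assoc, ← h5, ← Matrix.mul_assoc, conjTranspose_mul_self_of_mem_K hu,
    Matrix.one_mul]

/-- `f₂ b f₂⁻¹` need not be upper triangular, only block upper triangular, so it is factored again.
Its unitary factor lies in `K₊`, whence `k` changes to `f₁ k f` with `f` in `K₊`, and `L` to `f† L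
f`. -/
theorem Phi_invariant {n : ℕ} (l : ℕ) {f₁ f₂ : M n} (h₁ : f₁ ∈ Kplus n) (h₂ : f₂ ∈ Kplus n)
    (g : M n) : Phi l (f₁ * g * f₂⁻¹) = Phi l g := by
  have hf₂ := commute_Inn_of_mem_Kplus h₂
  have hf₂' := commute_Inn_of_mem_Kplus ((Kplus n).inv_mem h₂)
  set x := f₂ * bPart g * f₂⁻¹ with hx
  have hu : kPart x ∈ Kplus n := by
    have hb := isBlockUpper_of_mem_B (bPart_mem g)
    have hb' := isBlockUpper_of_mem_B ((B n).inv_mem (bPart_mem g))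
    refine kPart_mem_Kplus ?_ ?_
    · rw [hx, Matrix.SpecialLinearGroup.coe_mul, Matrix.SpecialLinearGroup.coe_mul]
      exact ((isBlockUpper_of_commute hf₂).mul hb).mul (isBlockUpper_of_commute hf₂')
    · have e : x⁻¹ = f₂ * (bPart g)⁻¹ * f₂⁻¹ := by rw [hx]; group
      rw [e, Matrix.SpecialLinearGroup.coe_mul, Matrix.SpecialLinearGroup.coe_mul]
      exact ((isBlockUpper_of_commute hf₂).mul hb').mul (isBlockUpper_of_commute hf₂')
  set f := f₂⁻¹ * kPart x with hf
  have hfK : f ∈ Kplus n := (Kplus n).mul_mem ((Kplus n).inv_mem h₂) hu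
  have hk : kPart (f₁ * g * f₂⁻¹) = f₁ * kPart g * f := by
    have e : f₁ * g * f₂⁻¹ = (f₁ * kPart g * f) * bPart x := by
      rw [hf, mul_assoc _ (f₂⁻¹ * kPart x), mul_assoc f₂⁻¹, kPart_mul_bPart, hx]
      nth_rw 1 [← kPart_mul_bPart g]
      group
    rw [e]
    exact (parts_eq ((K n).mul_mem ((K n).mul_mem h₁.1 (kPart_mem g)) hfK.1) (bPart_mem x)).1
  have hL : L (f₁ * g * f₂⁻¹) = (f : Mat n)ᴴ * (L g * (f : Mat n)) := by
    rw [L, hk, Matrix.SpecialLinearGroup.coe_mul, Matrix.SpecialLinearGroup.coe_mul,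
      conjTranspose_mul, conjTranspose_mul]
    calc (f : Mat n)ᴴ * ((kPart g : Mat n)ᴴ * (f₁ : Mat n)ᴴ) * Inn n *
          ((f₁ : Mat n) * (kPart g : Mat n) * (f : Mat n)) * Inn n
        = (f : Mat n)ᴴ * (kPart g : Mat n)ᴴ * ((f₁ : Mat n)ᴴ * Inn n * (f₁ : Mat n)) *
          (kPart g : Mat n) * ((f : Mat n) * Inn n) := by simp only [Matrix.mul_assoc]
      _ = (f : Mat n)ᴴ * (kPart g : Mat n)ᴴ * Inn n * (kPart g : Mat n) * (Inn n * (f : Mat n)) := by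
          rw [h₁.2, commute_Inn_of_mem_Kplus hfK]
      _ = _ := by rw [L]; simp only [Matrix.mul_assoc]
  rw [Phi, Phi, hL, trace_mul_pow_comm, Matrix.mul_assoc, mul_conjTranspose_self_of_mem_K hfK.1,
    Matrix.mul_one]

/-! ### The flow of `F l` -/

theorem eq_of_hasDerivAt_zero {E : Type*} [NormedAddCommGroup E] [NormedSpace ℝ E] {f : ℝ → E}
    {a b : ℝ} (hf : ∀ t ∈ Set.Ioo a b, HasDerivAt f 0 t) {s t : ℝ} (hs : s ∈ Set.Ioo a b)
    (ht : t ∈ Set.Ioo a b) : f s = f t :=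
  isOpen_Ioo.is_const_of_deriv_eq_zero isPreconnected_Ioo
    (fun x hx => (hf x hx).differentiableAt.differentiableWithinAt)
    (fun x hx => (hf x hx).deriv) hs ht

theorem commute_iTraceless {n : ℕ} (P : Mat n) (l : ℕ) : Commute P (iTraceless (P ^ l)) :=
  ((Commute.self_pow P l).sub_right ((Commute.one_right P).smul_right _)).smul_right _

theorem generatesCompleteFlow_hamF {n : ℕ} (hn : 1 ≤ n) (l : ℕ) :
    GeneratesCompleteFlow (hamF l : M n → Mat n) := by
  have hC : ∀ g : M n, iTraceless (((g : Mat n)ᴴ * (g : Mat n)) ^ l) ∈ lieK n := fun g =>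
    iTraceless_mem_lieK hn (hermitian_pow_conjTranspose_mul _ l)
  have hCc : Continuous fun g : M n => iTraceless (((g : Mat n)ᴴ * (g : Mat n)) ^ l) := by
    have h := (SmoothExt.coe (n := n)).conjTranspose.mul SmoothExt.coe
    have h1 := (h.pow l).continuous
    have h2 := (h.pow l).trace.continuous
    unfold iTraceless
    exact (h1.sub ((continuous_const.mul h2).smul continuous_const)).const_smul Complex.I
  let σ : ℝ → M n → M n := fun t g => g * expSL (t • ⟨_, (hC g).2⟩)
  have hσ : ∀ t g, (σ t g : Mat n) =
      (g : Mat n) * NormedSpace.exp (t • iTraceless (((g : Mat n)ᴴ * (g : Mat n)) ^ l)) :=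
    fun t g => rfl
  -- `C` is skew-Hermitian and commutes with `g†g`, so `exp (tC)` is unitary and commutes with it
  -- too.
  have hinv : ∀ t g, (σ t g : Mat n)ᴴ * (σ t g : Mat n) = (g : Mat n)ᴴ * (g : Mat n) := by
    intro t g
    have hcomm := commute_iTraceless ((g : Mat n)ᴴ * (g : Mat n)) l
    set C := iTraceless (((g : Mat n)ᴴ * (g : Mat n)) ^ l) with hCdef
    have e1 : (NormedSpace.exp (t • C))ᴴ * NormedSpace.exp (t • C) = 1 := by
      rw [← Matrix.exp_conjTranspose, conjTranspose_smul, (hC g).1, star_trivial, smul_neg,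
        ← Matrix.exp_add_of_commute _ _ (Commute.neg_left (Commute.refl (t • C))), neg_add_cancel,
        NormedSpace.exp_zero]
    have e2 : Commute ((g : Mat n)ᴴ * (g : Mat n)) (NormedSpace.exp (t • C)) :=
      (hcomm.smul_right t).exp_right
    rw [hσ, conjTranspose_mul, Matrix.mul_assoc, ← Matrix.mul_assoc (g : Mat n)ᴴ, e2.eq,
      ← Matrix.mul_assoc, e1, Matrix.one_mul]
  refine generatesCompleteFlow_of_integralCurves σ ?_ ?_ ?_ ?_
  · refine continuous_induced_rng.2 ?_
    have h1 : Continuous fun p : ℝ × M n => (p.2 : Mat n) :=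
      SmoothExt.coe.continuous.comp continuous_snd
    have h2 : Continuous fun p : ℝ × M n => NormedSpace.exp
        (p.1 • iTraceless (((p.2 : Mat n)ᴴ * (p.2 : Mat n)) ^ l)) :=
      NormedSpace.exp_continuous.comp (continuous_fst.smul (hCc.comp continuous_snd))
    exact h1.mul h2
  · intro g
    apply Subtype.ext
    rw [hσ, zero_smul, NormedSpace.exp_zero, Matrix.mul_one]
  · intro g t
    have h := hasDerivAt_matrix_mul (hasDerivAt_const t (g : Mat n)) (hasDerivAt_exp_smul_const
      (𝕂 := ℝ) (iTraceless (((g : Mat n)ᴴ * (g : Mat n)) ^ l)) t)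
    refine h.congr_deriv ?_
    rw [hamF, hinv, Matrix.zero_mul, zero_add, hσ, Matrix.mul_assoc]
    rfl
  · intro a b γ ha hb hγ t ht
    -- Conservation of `g†g` along an arbitrary integral curve freezes `C`; then `γ(s) exp(-sC)` has
    -- zero derivative, which gives uniqueness.
    have hP : ∀ s ∈ Set.Ioo a b, (γ s : Mat n)ᴴ * (γ s : Mat n) =
        (γ 0 : Mat n)ᴴ * (γ 0 : Mat n) := by
      intro s hs
      refine eq_of_hasDerivAt_zero (f := fun s => (γ s : Mat n)ᴴ * (γ s : Mat n))
        (fun r hr => ?_) hs ⟨ha, hb⟩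
      have h := hasDerivAt_matrix_mul (hasDerivAt_conjTranspose (hγ r hr)) (hγ r hr)
      refine h.congr_deriv ?_
      rw [hamF, conjTranspose_mul, (hC _).1, Matrix.mul_assoc, ← Matrix.mul_assoc (γ r : Mat n)ᴴ,
        (commute_iTraceless _ l).eq, Matrix.neg_mul, neg_add_cancel]
    set C := iTraceless (((γ 0 : Mat n)ᴴ * (γ 0 : Mat n)) ^ l) with hCdef
    have hconst := eq_of_hasDerivAt_zero
      (f := fun s => (γ s : Mat n) * NormedSpace.exp (s • (-C))) (fun r hr => by
        have h := hasDerivAt_matrix_mul (hγ r hr) (hasDerivAt_exp_smul_const' (𝕂 := ℝ) (-C) r)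
        refine h.congr_deriv ?_
        rw [hamF, hP r hr, ← hCdef, Matrix.mul_assoc, ← Matrix.mul_add, ← Matrix.add_mul,
          add_neg_cancel, Matrix.zero_mul, Matrix.mul_zero]) ht ⟨ha, hb⟩
    simp only [zero_smul, NormedSpace.exp_zero, Matrix.mul_one] at hconst
    apply Subtype.ext
    rw [hσ, ← hCdef, ← hconst, Matrix.mul_assoc, ← Matrix.exp_add_of_commute, smul_neg,
      neg_add_cancel, NormedSpace.exp_zero, Matrix.mul_one]
    rw [smul_neg]
    exact Commute.neg_left (Commute.refl (t • C))

/-! ### Strictly block upper triangular linear systems -/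

/-- Matrices supported in the upper right block. -/
def IsCorner {n : ℕ} (X : Mat n) : Prop := ∀ i j, ¬(i.val < n ∧ n ≤ j.val) → X i j = 0

theorem isCorner_smul_block {n : ℕ} (c : ℂ) (X : Mat n) :
    IsCorner (c • ((1 + Inn n) * X * (1 - Inn n))) := fun i j h => by
  rw [Matrix.smul_apply, block_apply, if_neg h, smul_zero]

/-- This truncates the series solving `h' = q h` after its first-order term: the solution is `(1 + ∫
q) h(0)`. -/
theorem IsCorner.mul_eq_zero {n : ℕ} {X Y : Mat n} (hX : IsCorner X) (hY : IsCorner Y) :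
    X * Y = 0 := by
  ext i j
  rw [Matrix.mul_apply, Matrix.zero_apply]
  refine Finset.sum_eq_zero fun m _ => ?_
  rcases lt_or_ge m.val n with hm | hm
  · rw [hX i m (by omega), zero_mul]
  · rw [hY m j (by omega), mul_zero]

theorem IsCorner.integral {n : ℕ} {q : ℝ → Mat n} (hq : Continuous q) (hc : ∀ t, IsCorner (q t))
    (t : ℝ) : IsCorner (∫ s in (0 : ℝ)..t, q s) := by
  intro i j h
  have e := ContinuousLinearMap.intervalIntegral_comp_comm (μ := MeasureTheory.volume)
    (Matrix.entryLinearMap ℝ ℂ i j : Mat n →ₗ[ℝ] ℂ).toContinuousLinearMap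
    (hq.intervalIntegrable 0 t)
  have e1 : (∫ s in (0 : ℝ)..t, q s) i j = ∫ s in (0 : ℝ)..t, q s i j := e.symm
  rw [e1]
  simp only [hc _ i j h, intervalIntegral.integral_zero]

/-- Keeps solutions of the linear equation in the group, and the triangular factor in `B`. -/
theorem IsCorner.exists_mem_B {n : ℕ} {X : Mat n} (hX : IsCorner X) :
    ∃ U : M n, U ∈ B n ∧ (U : Mat n) = 1 + X := by
  have h1 : ∀ i j : Fin (2 * n), j < i → (1 + X) i j = 0 := fun i j hij => by
    have : j.val < i.val := hij
    rw [Matrix.add_apply, Matrix.one_apply_ne hij.ne', hX i j (by omega), add_zero]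
  have h2 : ∀ i : Fin (2 * n), (1 + X) i i = 1 := fun i => by
    rw [Matrix.add_apply, Matrix.one_apply_eq, hX i i (by omega), add_zero]
  have hdet : (1 + X).det = 1 := by
    rw [Matrix.det_of_isUpperTriangular (M := 1 + X) (fun i j h => h1 i j h)]
    exact Finset.prod_eq_one fun i _ => h2 i
  refine ⟨⟨1 + X, hdet⟩, ⟨h1, fun i => ?_⟩, rfl⟩
  show 0 < ((1 + X) i i).re ∧ ((1 + X) i i).im = 0
  rw [h2]; simp

theorem hasDerivAt_one_add_integral {n : ℕ} {q : ℝ → Mat n} (hq : Continuous q) (t : ℝ) :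
    HasDerivAt (fun u => 1 + ∫ s in (0 : ℝ)..u, q s) (q t) t :=
  (hq.integral_hasStrictDerivAt 0 t).hasDerivAt.const_add 1

theorem hasDerivAt_corner_solution {n : ℕ} {q : ℝ → Mat n} (hq : Continuous q)
    (hc : ∀ t, IsCorner (q t)) (x : Mat n) (t : ℝ) :
    HasDerivAt (fun u => (1 + ∫ s in (0 : ℝ)..u, q s) * x)
      (q t * ((1 + ∫ s in (0 : ℝ)..t, q s) * x)) t := by
  refine (hasDerivAt_matrix_mul (hasDerivAt_one_add_integral hq t)
    (hasDerivAt_const t x)).congr_deriv ?_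
  rw [Matrix.mul_zero, add_zero, ← Matrix.mul_assoc, Matrix.mul_add,
    (hc t).mul_eq_zero (IsCorner.integral hq hc t), Matrix.mul_one, add_zero]

theorem corner_solution_unique {n : ℕ} {q : ℝ → Mat n} (hq : Continuous q)
    (hc : ∀ t, IsCorner (q t)) {h : ℝ → Mat n} {a b : ℝ} (ha : a < 0) (hb : 0 < b)
    (hh : ∀ t ∈ Set.Ioo a b, HasDerivAt h (q t * h t) t) {t : ℝ} (ht : t ∈ Set.Ioo a b) :
    h t = (1 + ∫ s in (0 : ℝ)..t, q s) * h 0 := by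
  -- `1 - ∫ q` is the inverse of `1 + ∫ q`, since the square of the integral vanishes; applied to a
  -- solution it gives a constant.
  have hconst := eq_of_hasDerivAt_zero
    (f := fun u => (1 - ∫ s in (0 : ℝ)..u, q s) * h u) (fun r hr => by
      have h1 : HasDerivAt (fun u => 1 - ∫ s in (0 : ℝ)..u, q s) (-q r) r :=
        (hq.integral_hasStrictDerivAt 0 r).hasDerivAt.const_sub 1
      refine (hasDerivAt_matrix_mul h1 (hh r hr)).congr_deriv ?_
      rw [Matrix.sub_mul, ← Matrix.mul_assoc (∫ s in (0 : ℝ)..r, q s),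
        (IsCorner.integral hq hc r).mul_eq_zero (hc r), Matrix.zero_mul, Matrix.one_mul, sub_zero,
        Matrix.neg_mul, neg_add_cancel]) ht ⟨ha, hb⟩
  simp only [intervalIntegral.integral_same, sub_zero, Matrix.one_mul] at hconst
  have h2 := IsCorner.integral hq hc t
  rw [← hconst, ← Matrix.mul_assoc, Matrix.add_mul, Matrix.mul_sub, Matrix.mul_sub,
    h2.mul_eq_zero h2]
  simp

/-! ### The flow of `Phi l` -/

theorem exists_norm_le_of_unitary (n : ℕ) :
    ∃ r : ℝ, 0 < r ∧ ∀ k : Mat n, kᴴ * k = 1 → ‖k‖ ≤ r := by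
  -- A crude bound from entries of modulus at most `1`; the added `1` keeps the radius positive.
  refine ⟨∑ i, ∑ j, ‖(Matrix.single i j 1 : Mat n)‖ + 1, by positivity, fun k hk => ?_⟩
  have hU : k ∈ Matrix.unitaryGroup (Fin (2 * n)) ℂ := Matrix.mem_unitaryGroup_iff'.2 hk
  refine le_trans ?_ (le_add_of_nonneg_right zero_le_one)
  conv_lhs => rw [Matrix.matrix_eq_sum_single k]
  refine (norm_sum_le _ _).trans (Finset.sum_le_sum fun i _ => (norm_sum_le _ _).trans
    (Finset.sum_le_sum fun j _ => ?_))
  have e : Matrix.single i j (k i j) = k i j • (Matrix.single i j 1 : Mat n) := by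
    rw [Matrix.smul_single, smul_eq_mul, mul_one]
  rw [e]
  refine (norm_smul_le _ _).trans ?_
  exact mul_le_of_le_one_left (norm_nonneg _) (entry_norm_bound_of_unitary hU i j)

theorem contDiff_conjTranspose {n : ℕ} : ContDiff ℝ ∞ (fun k : Mat n => kᴴ) :=
  (Matrix.conjTransposeLinearEquiv (Fin (2 * n)) (Fin (2 * n)) ℝ
    ℂ).toLinearMap.toContinuousLinearMap.contDiff

theorem contDiff_Lmat_pow {n : ℕ} (l : ℕ) : ContDiff ℝ ∞ (fun k : Mat n => Lmat k ^ l) :=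
  (((contDiff_conjTranspose.mul contDiff_const).mul contDiff_id).mul contDiff_const).pow l

theorem contDiff_rotA {n : ℕ} (l : ℕ) : ContDiff ℝ ∞ (rotA l : Mat n → Mat n) := by
  have hI : ContDiff ℝ ∞ (fun _ : Mat n => Inn n) := contDiff_const
  exact ((((hI.mul (contDiff_Lmat_pow (l - 1))).sub ((contDiff_Lmat_pow (l + 1)).mul hI)).sub
    (hI.mul (contDiff_Lmat_pow l))).add ((contDiff_Lmat_pow l).mul hI)).const_smul (Complex.I / 2)

theorem continuous_transQ {n : ℕ} (l : ℕ) : Continuous (transQ l : Mat n → Mat n) := by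
  have h := (contDiff_Lmat_pow (n := n) l).continuous
  have h1 := (contDiff_conjTranspose (n := n)).continuous
  exact ((continuous_const.mul ((continuous_id.mul h).mul h1)).mul continuous_const).const_smul
    (Complex.I / 2)

theorem continuous_transN {n : ℕ} (l : ℕ) : Continuous (transN l : Mat n → Mat n) :=
  ((continuous_const.mul (contDiff_Lmat_pow (n := n) l).continuous).mul
    continuous_const).const_smul (Complex.I / 2)

open scoped NNReal in
/-- The equation `k' = k (rotA l k)` has a global continuous flow on unitary matrices and is given
there by a Lipschitz vector field. -/
theorem exists_rotA_flow (n l : ℕ) : ∃ (w : Mat n → Mat n) (κ : ℝ≥0) (ψ : ℝ → Mat n → Mat n),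
    LipschitzWith κ w ∧ (∀ k, kᴴ * k = 1 → w k = k * rotA l k) ∧
    Continuous (Function.uncurry ψ) ∧ (∀ k, ψ 0 k = k) ∧
    ∀ k, kᴴ * k = 1 → ∀ t, (ψ t k)ᴴ * ψ t k = 1 ∧
      HasDerivAt (fun s => ψ s k) (ψ t k * rotA l (ψ t k)) t := by
  obtain ⟨r, hr, hball⟩ := exists_norm_le_of_unitary n
  -- The cutoff equals `1` on a ball containing all unitary matrices, so the field is unchanged
  -- there and becomes bounded and Lipschitz. It multiplies `rotA` by a real scalar, so skewness
  -- survives everywhere.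
  let χ : ContDiffBump (0 : Mat n) := ⟨r, r + 1, hr, by linarith⟩
  let a : Mat n → Mat n := fun k => χ k • rotA l k
  have ha : ContDiff ℝ ∞ a := χ.contDiff.smul (contDiff_rotA l)
  have hac : HasCompactSupport a := χ.hasCompactSupport.smul_right
  have has : ∀ k, (a k)ᴴ = -a k := fun k => by
    simp only [a, conjTranspose_smul, rotA_skew, star_trivial, smul_neg]
  let w : Mat n → Mat n := fun k => k * a k
  have hw : ContDiff ℝ ∞ w := contDiff_id.mul ha
  have hwc : HasCompactSupport w := hac.mul_left
  obtain ⟨κ, hκ⟩ := hw.lipschitzWith_of_hasCompactSupport hwc (by simp)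
  obtain ⟨C, hC⟩ := hwc.exists_bound_of_continuous hw.continuous
  obtain ⟨c, hc⟩ := hac.exists_bound_of_continuous ha.continuous
  obtain ⟨ψ, hψc, hψ0, hψ⟩ := exists_global_flow_of_lipschitz (C := C.toNNReal) hκ
    (fun x => (hC x).trans (Real.le_coe_toNNReal C))
  have hwu : ∀ k, kᴴ * k = 1 → w k = k * rotA l k := fun k hk => by
    have h1 : χ k = 1 := χ.one_of_mem_closedBall (by simpa [χ] using hball k hk)
    simp only [w, a, h1, one_smul]
  refine ⟨w, κ, ψ, hκ, hwu, hψc, hψ0, fun k hk => ?_⟩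
  -- By skewness `X = ψ†ψ` solves the linear equation `X' = X a - a X`, of which `1` is a constant
  -- solution; the constant `2c` bounds the commutator.
  have hunit : (fun t => (ψ t k)ᴴ * ψ t k) = fun _ => 1 := by
    refine ODE_solution_unique_univ (t₀ := 0) (K := 2 * c.toNNReal) (s := fun _ => Set.univ)
      (v := fun t X => X * a (ψ t k) - a (ψ t k) * X) (fun t => ?_) (fun t => ⟨?_, trivial⟩)
      (fun t => ⟨?_, trivial⟩) (by rw [hψ0, hk])
    · refine LipschitzWith.lipschitzOnWith (LipschitzWith.of_dist_le_mul fun X Y => ?_)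
      rw [dist_eq_norm, dist_eq_norm]
      have e : X * a (ψ t k) - a (ψ t k) * X - (Y * a (ψ t k) - a (ψ t k) * Y) =
          (X - Y) * a (ψ t k) - a (ψ t k) * (X - Y) := by noncomm_ring
      have hc' : ‖a (ψ t k)‖ ≤ c.toNNReal := (hc _).trans (Real.le_coe_toNNReal c)
      rw [e]
      calc _ ≤ ‖(X - Y) * a (ψ t k)‖ + ‖a (ψ t k) * (X - Y)‖ := norm_sub_le _ _
        _ ≤ ‖X - Y‖ * ‖a (ψ t k)‖ + ‖a (ψ t k)‖ * ‖X - Y‖ :=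
          add_le_add (norm_mul_le _ _) (norm_mul_le _ _)
        _ = (2 * ‖a (ψ t k)‖) * ‖X - Y‖ := by ring
        _ ≤ (2 * c.toNNReal) * ‖X - Y‖ := by gcongr
    · have h := hasDerivAt_matrix_mul (hasDerivAt_conjTranspose (hψ k t)) (hψ k t)
      refine h.congr_deriv ?_
      simp only [w]
      rw [conjTranspose_mul, has]
      noncomm_ring
    · refine (hasDerivAt_const t (1 : Mat n)).congr_deriv ?_
      rw [Matrix.one_mul, Matrix.mul_one, sub_self]
  intro t
  have h1 := congrFun hunit t
  exact ⟨h1, hwu _ h1 ▸ hψ k t⟩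

/-- Since `b = k† g`, the field `k (A + N) b` is `k (A + N) k† g`; along a known `k(t)` the equation
for `g` is linear. -/
theorem hamPhi_eq_transQ {n : ℕ} {l : ℕ} (hl : 1 ≤ l) (g : M n) :
    hamPhi l g = transQ l (kPart g : Mat n) * (g : Mat n) := by
  have hk := conjTranspose_mul_self_of_mem_K (kPart_mem g)
  rw [← rotA_add_transN hl hk, Matrix.mul_assoc, ← coe_bPart_eq, Matrix.mul_add, Matrix.add_mul,
    Matrix.mul_assoc _ (transN l _)]
  rfl

theorem generatesCompleteFlow_hamPhi {n : ℕ} {l : ℕ} (hl : 1 ≤ l) :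
    GeneratesCompleteFlow (hamPhi l : M n → Mat n) := by
  obtain ⟨w, κ, ψ, hw, hwu, hψc, hψ0, hψ⟩ := exists_rotA_flow n l
  have hψt : ∀ k, Continuous fun t => ψ t k := fun k =>
    hψc.comp (continuous_id.prodMk continuous_const)
  let q : M n → ℝ → Mat n := fun g t => transQ l (ψ t (kPart g : Mat n))
  have hq : ∀ g, Continuous (q g) := fun g => (continuous_transQ l).comp (hψt _)
  have hqc : ∀ g t, IsCorner (q g t) := fun g t => isCorner_smul_block _ _
  have hU : ∀ g t, ∃ U : M n, (U : Mat n) = 1 + ∫ s in (0 : ℝ)..t, q g s := fun g t => by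
    obtain ⟨U, -, h⟩ := (IsCorner.integral (hq g) (hqc g) t).exists_mem_B
    exact ⟨U, h⟩
  choose U hUc using hU
  let σ : ℝ → M n → M n := fun t g => U g t * g
  have hσ : ∀ t g, (σ t g : Mat n) = (1 + ∫ s in (0 : ℝ)..t, q g s) * (g : Mat n) := fun t g => by
    simp only [σ, Matrix.SpecialLinearGroup.coe_mul, hUc]
  -- Consistency: the unitary factor of `(1 + ∫ Q) g` must be the curve `ψ t k` used to define `Q`.
  -- The curve `ψ t k · (1 + ∫ N) b` solves the same linear equation with the same initial value,
  -- and it is visibly factored into `K` times `B`.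
  have hkσ : ∀ t g, (kPart (σ t g) : Mat n) = ψ t (kPart g : Mat n) := by
    intro t g
    have hu := hψ _ (conjTranspose_mul_self_of_mem_K (kPart_mem g))
    have hN : Continuous fun s => transN l (ψ s (kPart g : Mat n)) :=
      (continuous_transN l).comp (hψt _)
    have hNc : ∀ s, IsCorner (transN l (ψ s (kPart g : Mat n))) := fun s =>
      isCorner_smul_block _ _
    obtain ⟨u, huB, huc⟩ := (IsCorner.integral hN hNc t).exists_mem_B
    have hsol := corner_solution_unique (hq g) (hqc g) (a := -(|t| + 1)) (b := |t| + 1) (t := t)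
      (h := fun r => ψ r (kPart g : Mat n) *
        ((1 + ∫ s in (0 : ℝ)..r, transN l (ψ s (kPart g : Mat n))) * (bPart g : Mat n)))
      (by linarith [abs_nonneg t]) (by linarith [abs_nonneg t]) (fun r _ => by
        refine (hasDerivAt_matrix_mul (hu r).2
          (hasDerivAt_corner_solution hN hNc (bPart g : Mat n) r)).congr_deriv ?_
        simp only [q]
        rw [← rotA_add_transN hl (hu r).1]
        simp only [Matrix.mul_assoc, Matrix.mul_add, Matrix.add_mul]
        simp only [← Matrix.mul_assoc (ψ r _)ᴴ (ψ r _), (hu r).1, Matrix.one_mul]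
        abel)
      ⟨by linarith [neg_abs_le t], by linarith [le_abs_self t]⟩
    simp only [intervalIntegral.integral_same, add_zero, Matrix.one_mul, hψ0,
      coe_kPart_mul_coe_bPart] at hsol
    rw [← hσ, ← huc] at hsol
    set k := σ t g * (u * bPart g)⁻¹ with hkdef
    have hkc : (k : Mat n) = ψ t (kPart g : Mat n) := by
      rw [hkdef, Matrix.SpecialLinearGroup.coe_mul, ← hsol, ← Matrix.SpecialLinearGroup.coe_mul,
        Matrix.mul_assoc, coe_mul_coe_inv, Matrix.mul_one]
    have hkK : k ∈ K n := by
      show (k : Mat n)ᴴ * (k : Mat n) = 1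
      rw [hkc]
      exact (hu t).1
    have hkb : σ t g = k * (u * bPart g) := by rw [hkdef, inv_mul_cancel_right]
    rw [hkb, (parts_eq hkK ((B n).mul_mem huB (bPart_mem g))).1, hkc]
  refine generatesCompleteFlow_of_integralCurves σ ?_ ?_ ?_ ?_
  · refine continuous_induced_rng.2 ?_
    have h1 : Continuous fun p : ℝ × M n => (p.2 : Mat n) :=
      SmoothExt.coe.continuous.comp continuous_snd
    have h2 : Continuous (Function.uncurry fun (p : ℝ × M n) (s : ℝ) => q p.2 s) :=
      (continuous_transQ l).comp (hψc.comp (continuous_snd.prodMk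
        (smoothExt_kPart.continuous.comp (continuous_snd.comp continuous_fst))))
    have h3 := intervalIntegral.continuous_parametric_intervalIntegral_of_continuous
      (μ := MeasureTheory.volume) (a₀ := 0) h2 (continuous_fst (X := ℝ) (Y := M n))
    exact ((continuous_const.add h3).mul h1).congr fun p => (hσ p.1 p.2).symm
  · intro g
    apply Subtype.ext
    rw [hσ]
    simp
  · intro g t
    rw [hamPhi_eq_transQ hl, hkσ]
    simp only [hσ]
    exact hasDerivAt_corner_solution (hq g) (hqc g) (g : Mat n) t
  · intro a b γ ha hb hγ
    have hu := hψ _ (conjTranspose_mul_self_of_mem_K (kPart_mem (γ 0)))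
    -- Uniqueness in two stages: the unitary factor of an integral curve solves the Lipschitz
    -- equation for `k`, so it is `ψ`; then the curve itself solves the linear equation.
    have hk : Set.EqOn (fun s => (kPart (γ s) : Mat n)) (fun s => ψ s (kPart (γ 0) : Mat n))
        (Set.Ioo a b) := by
      refine ODE_solution_unique_of_mem_Ioo (v := fun _ => w) (s := fun _ => Set.univ) (K := κ)
        (t₀ := 0) (fun _ _ => hw.lipschitzOnWith) ⟨ha, hb⟩ (fun s hs => ⟨?_, trivial⟩)
        (fun s _ => ⟨?_, trivial⟩) (hψ0 _).symm
      · rw [hwu _ (conjTranspose_mul_self_of_mem_K (kPart_mem _))]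
        exact ((hasComponents_hamPhi_rotA hl (γ s)).hasDerivAt (hγ s hs)).1
      · rw [hwu _ (hu s).1]
        exact (hu s).2
    intro t ht
    apply Subtype.ext
    rw [hσ]
    refine corner_solution_unique (hq (γ 0)) (hqc (γ 0)) (h := fun s => (γ s : Mat n)) ha hb
      (fun s hs => ?_) ht
    have h := hγ s hs
    rw [hamPhi_eq_transQ hl] at h
    have hks : (kPart (γ s) : Mat n) = ψ s (kPart (γ 0) : Mat n) := hk hs
    rwa [hks] at h

end HeisenbergDouble

/-! ### Assembly of the claims. -/

open HeisenbergDouble in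
theorem proposition2p1 (n : ℕ) (hn : 1 ≤ n) :
    -- the functions are smooth, and the traces that define them are real
    (∀ l : ℕ, 1 ≤ l →
      (IsSmooth (F l : M n → ℝ) ∧ ∀ g : M n, (F l g : ℂ) = 1 / (2 * (l : ℂ)) * (Om g ^ l).trace) ∧
      (IsSmooth (Phi l : M n → ℝ) ∧
        ∀ g : M n, (Phi l g : ℂ) = 1 / (2 * (l : ℂ)) * (L g ^ l).trace)) ∧
    -- invariance under `K₊ × K₊`, acting by `(f₁, f₂) : g ↦ f₁ g f₂† = f₁ g f₂⁻¹`
    (∀ l : ℕ, 1 ≤ l → ∀ f₁ ∈ Kplus n, ∀ f₂ ∈ Kplus n, ∀ g : M n,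
      F l (f₁ * g * f₂⁻¹) = F l g ∧ Phi l (f₁ * g * f₂⁻¹) = Phi l g) ∧
    -- involution
    (∀ l₁ l₂ : ℕ, 1 ≤ l₁ → 1 ≤ l₂ → ∀ g : M n,
      bracket (F l₁) (F l₂) g = 0 ∧ bracket (Phi l₁) (Phi l₂) g = 0) ∧
    -- the Hamiltonian vector field of `F l`
    (∀ l : ℕ, 1 ≤ l → ∃ V : M n → Mat n,
      IsHamiltonianVectorField (F l) V ∧
      (∀ W : M n → Mat n, IsHamiltonianVectorField (F l) W → W = V) ∧
      (∀ g : M n, HasComponents g (V g)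
        (Complex.I • ((kPart g : Mat n) *
          (Om g ^ l - ((2 * (n : ℂ))⁻¹ * (Om g ^ l).trace) • (1 : Mat n))))
        0) ∧
      GeneratesCompleteFlow V) ∧
    -- the Hamiltonian vector field of `Phi l`
    (∀ l : ℕ, 1 ≤ l → ∃ V : M n → Mat n,
      IsHamiltonianVectorField (Phi l) V ∧
      (∀ W : M n → Mat n, IsHamiltonianVectorField (Phi l) W → W = V) ∧
      (∀ g : M n, HasComponents g (V g)
        ((Complex.I / 2) • ((kPart g : Mat n) *
          (Inn n * L g ^ (l - 1) - L g ^ (l + 1) * Inn n - Inn n * L g ^ l + L g ^ l * Inn n)))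
        ((Complex.I / 2) • ((1 + Inn n) * L g ^ l * (1 - Inn n) * (bPart g : Mat n)))) ∧
      GeneratesCompleteFlow V) := by
  refine ⟨fun l _ => ⟨⟨isSmooth_F l, F_ofReal l⟩, isSmooth_Phi l, Phi_ofReal l⟩,
    fun l _ f₁ h₁ f₂ h₂ g => ⟨F_invariant l h₁.1 h₂.1 g, Phi_invariant l h₁ h₂ g⟩,
    fun l₁ l₂ h₁ h₂ g => ⟨bracket_F_F hn h₂ h₁ g, bracket_Phi_Phi h₂ h₁ g⟩,
    fun l hl => ⟨hamF l, isHamiltonianVectorField_hamF hn hl,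
      fun W hW => (isHamiltonianVectorField_hamF hn hl).unique hW, hasComponents_hamF hn l,
      generatesCompleteFlow_hamF hn l⟩,
    fun l hl => ⟨hamPhi l, isHamiltonianVectorField_hamPhi hl,
      fun W hW => (isHamiltonianVectorField_hamPhi hl).unique hW, hasComponents_hamPhi hl,
      generatesCompleteFlow_hamPhi hl⟩⟩
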